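/- Let $\Gamma\colon[0,1]\to\mathbb C$ be a piecewise smooth curve (continuous, and for some subdivision of $[0,1]$ of class $C^2$ with nowhere vanishing velocity on each closed piece), and let $U''\subset U'\subset U\subset\mathbb C$ be path connected open sets with $\Gamma\subset U''$, such that $\overline U$ is compact and simply connected. Let $f$ be holomorphic on (a neighbourhood of) $\overline U$ with no zeros on $\Gamma$. Let $\varepsilon>0$ and $D$ be real numbers with $D/\varepsilon>3$ such that $$\rho(\Gamma,\partial U'')\ge\varepsilon,\qquad \rho(U'',\partial U')\ge\varepsilon,\qquad \rho(U',\partial U)\ge\varepsilon,$$ where $\rho(A,B)=\inf_{a\in A,\,b\in B}|a-b|$, and $$\operatorname{diam}_{\rm int}U''\le D,\qquad \operatorname{diam}_{\rm int}U'\le D.$$ Here the intrinsic diameter $\operatorname{diam}_{\rm int}K$ is the supremum, over pairs of points of $K$, of the infimum of the lengths of paths in $K$ joining them. Then $$V_\Gamma(f)\le B_{U'',U}(f)\left(\frac{|\Gamma|}{\varepsilon}+\kappa(\Gamma)+1\right)e^{5D/\varepsilon}.$$ Here $V_\Gamma(f)$ is the total variation on $[0,1]$ of a continuous branch of $\arg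 (f\circ\Gamma)$; $B_{U'',U}(f)=\log\bigl(\sup_U|f|\,/\,\sup_{U''}|f|\bigr)$ is the Bernstein index; $|\Gamma|$ is the length of $\Gamma$; and $\kappa(\Gamma)$ is its total curvature, i.e. the integral of the absolute value of the curvature with respect to arc length over the smooth pieces plus the sum of the exterior angles in $[0,\pi]$ at the interior vertices. -/

import Mathlib

open Set

open scoped ENNReal

noncomputable section

namespace PlanarArg

/-! ## Distances, intrinsic diameter, Bernstein index -/

/-- The distance `ρ(A, B) = inf {|a - b| : a ∈ A, b ∈ B}` between two sets of the plane
(`⊤` if one of them is empty). -/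
def setDist (A B : Set ℂ) : ℝ≥0∞ :=
  ⨅ a ∈ A, ⨅ b ∈ B, edist a b

/-- The intrinsic distance between two points of a set `K` of a metric space: the infimum of the
lengths of the paths that join them inside `K` (`⊤` if there is no path of finite length). -/
def intrinsicDist {X : Type*} [MetricSpace X] (K : Set X) (x y : X) : ℝ≥0∞ :=
  ⨅ (c : Path x y) (_ : ∀ s, c s ∈ K), eVariationOn c univ

/-- The intrinsic diameter of a set: the supremum of the intrinsic distances of its points. -/
def intrinsicDiam {X : Type*} [MetricSpace X] (K : Set X) : ℝ≥0∞ :=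
  ⨆ x ∈ K, ⨆ y ∈ K, intrinsicDist K x y

/-- The Bernstein index `B_{K,U}(f) = log (M / m)` with `M = sup_U |f|` and `m = sup_K |f|`. -/
def bernsteinIndex (K U : Set ℂ) (f : ℂ → ℂ) : ℝ :=
  Real.log (sSup ((fun z => ‖f z‖) '' U) / sSup ((fun z => ‖f z‖) '' K))

/-! ## Piecewise smooth curves -/

/-- A piecewise smooth curve `[0,1] → ℂ`: a continuous map together with a subdivision
`0 = node 0 < node 1 < ⋯ < node numPieces = 1`, such that on each closed piece the map is
twice continuously differentiable and regular (its velocity does not vanish, at the end points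
of the piece the one-sided velocity). -/
structure PiecewiseSmoothCurve where
  /-- the map; only its restriction to `[0,1]` matters -/
  toFun : ℝ → ℂ
  /-- the number of smooth pieces -/
  numPieces : ℕ
  /-- the subdivision points; only those with index at most `numPieces` matter -/
  node : ℕ → ℝ
  node_zero : node 0 = 0
  node_last : node numPieces = 1
  node_lt : ∀ i < numPieces, node i < node (i + 1)
  continuousOn : ContinuousOn toFun (Icc 0 1)
  contDiffOn : ∀ i < numPieces, ContDiffOn ℝ 2 toFun (Icc (node i) (node (i + 1)))
  regular : ∀ i < numPieces, ∀ t ∈ Icc (node i) (node (i + 1)),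
    derivWithin toFun (Icc (node i) (node (i + 1))) t ≠ 0

namespace PiecewiseSmoothCurve

variable (Γ : PiecewiseSmoothCurve)

/-- The set of points of the curve. -/
def trace : Set ℂ := Γ.toFun '' Icc 0 1

/-- The parameter interval of the `i`-th piece. -/
def piece (i : ℕ) : Set ℝ := Icc (Γ.node i) (Γ.node (i + 1))

/-- The velocity along the `i`-th piece (one-sided at its end points). -/
def velocity (i : ℕ) : ℝ → ℂ := derivWithin Γ.toFun (Γ.piece i)

/-- The acceleration along the `i`-th piece (one-sided at its end points). -/
def acceleration (i : ℕ) : ℝ → ℂ := derivWithin (Γ.velocity i) (Γ.piece i)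

/-- The (unsigned) curvature `|x' y'' - y' x''| / (x'² + y'²)^{3/2}` along the `i`-th piece. -/
def curvature (i : ℕ) (t : ℝ) : ℝ :=
  |(Γ.velocity i t).re * (Γ.acceleration i t).im - (Γ.velocity i t).im * (Γ.acceleration i t).re| /
    ‖Γ.velocity i t‖ ^ 3

/-- The length `|Γ|`, the integral of the speed. -/
def length : ℝ :=
  ∑ i ∈ Finset.range Γ.numPieces,
    ∫ t in (Γ.node i)..(Γ.node (i + 1)), ‖Γ.velocity i t‖

/-- The total curvature `κ(Γ)`: the integral of the curvature with respect to arc length over the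
smooth pieces, plus the exterior angles (in `[0, π]`, between the incoming and the outgoing
velocity) at the interior vertices. -/
def totalCurvature : ℝ :=
  (∑ i ∈ Finset.range Γ.numPieces,
    ∫ t in (Γ.node i)..(Γ.node (i + 1)), Γ.curvature i t * ‖Γ.velocity i t‖) +
  ∑ i ∈ Finset.range (Γ.numPieces - 1),
    InnerProductGeometry.angle (Γ.velocity i (Γ.node (i + 1)))
      (Γ.velocity (i + 1) (Γ.node (i + 1)))

end PiecewiseSmoothCurve

/-! ## Variation of argument -/

/-- `φ` is a continuous branch on `[0,1]` of the argument of `g : [0,1] → ℂ`. -/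
def IsArgBranch (g : ℝ → ℂ) (φ : ℝ → ℝ) : Prop :=
  ContinuousOn φ (Icc 0 1) ∧
    ∀ t ∈ Icc (0 : ℝ) 1, g t = ‖g t‖ * Complex.exp (φ t * Complex.I)

/-- The variation of argument along `[0,1]` of `g : [0,1] → ℂ`: the total variation of a continuous
branch of the argument. It does not depend on the branch if `g` has no zeros (see
`argVariation_eq` below); it is `⊤` if there is no continuous branch. -/
def argVariation (g : ℝ → ℂ) : ℝ≥0∞ :=
  ⨅ (φ : ℝ → ℝ) (_ : IsArgBranch g φ), eVariationOn φ (Icc 0 1)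

/-- The variation of argument `V_Γ(f)` of a function `f` along a curve `Γ`. -/
def variationOfArgument (Γ : PiecewiseSmoothCurve) (f : ℂ → ℂ) : ℝ≥0∞ :=
  argVariation (f ∘ Γ.toFun)

theorem IsArgBranch.eVariationOn_eq {g : ℝ → ℂ} {φ ψ : ℝ → ℝ} (hφ : IsArgBranch g φ)
    (hψ : IsArgBranch g ψ) (hg : ∀ t ∈ Icc (0 : ℝ) 1, g t ≠ 0) :
    eVariationOn φ (Icc 0 1) = eVariationOn ψ (Icc 0 1) := by
  have hpi := Real.two_pi_pos
  -- the difference of the two branches is an integer multiple of `2π`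
  have hint : ∀ t ∈ Icc (0 : ℝ) 1, ∃ n : ℤ, φ t - ψ t = n * (2 * Real.pi) := by
    intro t ht
    have h0 : (‖g t‖ : ℂ) ≠ 0 := by simpa using hg t ht
    have h1 : Complex.exp (φ t * Complex.I) = Complex.exp (ψ t * Complex.I) :=
      mul_left_cancel₀ h0 ((hφ.2 t ht).symm.trans (hψ.2 t ht))
    obtain ⟨n, hn⟩ := Complex.exp_eq_exp_iff_exists_int.mp h1
    refine ⟨n, ?_⟩
    have h2 := congrArg Complex.im hn
    simp at h2
    linarith
  -- hence constant
  have hconst : ∀ t ∈ Icc (0 : ℝ) 1, φ t = ψ t + (φ 0 - ψ 0) := by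
    choose! n hn using hint
    have hS : ContinuousOn (fun t => (φ t - ψ t) / (2 * Real.pi)) (Icc 0 1) :=
      (hφ.1.sub hψ.1).div_const _
    have hmaps : MapsTo (fun t => (φ t - ψ t) / (2 * Real.pi)) (Icc 0 1)
        (range ((↑) : ℤ → ℝ)) := by
      intro t ht
      refine ⟨n t, ?_⟩
      simp only [hn t ht]
      field_simp
    have hdisc : IsDiscrete (range ((↑) : ℤ → ℝ)) :=
      ⟨Int.isClosedEmbedding_coe_real.isEmbedding.toHomeomorph.discreteTopology⟩
    intro t ht
    have h := isPreconnected_Icc.constant_of_mapsTo hdisc hS hmaps ht (left_mem_Icc.2 zero_le_one)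
    rw [div_left_inj' hpi.ne'] at h
    linarith
  rw [eVariationOn.congr (g := fun t => ψ t + (φ 0 - ψ 0)) hconst]
  simp [eVariationOn]

/-- The variation of argument is the total variation of any continuous branch. -/
theorem argVariation_eq {g : ℝ → ℂ} {φ : ℝ → ℝ} (hφ : IsArgBranch g φ)
    (hg : ∀ t ∈ Icc (0 : ℝ) 1, g t ≠ 0) :
    argVariation g = eVariationOn φ (Icc 0 1) := by
  refine le_antisymm (iInf₂_le φ hφ) (le_iInf₂ fun ψ hψ => ?_)
  exact (hφ.eVariationOn_eq hψ hg).le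

end PlanarArg

end

/-! Let M be the supremum of |f| on U and take b above the Bernstein index, so that |f(w)| > M
e^{-b} at some w in U''. The disc of radius 2ε about any point of U'' lies in the closure of U,
where |f| ≤ M. With ρ = ε/4, three circles of radii at most ρ, 2ρ, 8ρ turn a lower bound M e^{-s}
attained in a disc of radius 2ρ into M e^{-3s/2} attained in the concentric disc of radius ρ.
Following a path in U'' from w takes at most 4D/ε + 1 steps of size ε/4. Hence every point of Γ has
within ε/4 a point z₁ with |f(z₁)| ≥ M e^{-β}, where β = b e^{2D/ε+1}
(`exists_le_norm_of_intrinsicDiam_le`).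

Near z₁ write f = P g, where P is a monic polynomial with at most 4β roots and g has no zeros within
3ε/4 of z₁ (`exists_eq_prod_mul`). Borel–Carathéodory and Cauchy bound g'/g by 80β/ε within ε/2 of
z₁ (`norm_logDeriv_le`). A root a contributes the variation of arg(Γ - a), and here curvature
enters. Let θ in [0, π] be the angle between Γ - a and the velocity. Where the rates exist, θ' is at
most the turning rate of the tangent minus the rotation rate of Γ - a, both in absolute value; at a
corner θ jumps by at most the exterior angle. So the total rotation about a is at most the curvature
of the arc plus π (`integral_abs_im_le`). An arc of length at most ε/4 and curvature κ therefore
costs at most 4βκ + 33β.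

Curvature adds up over consecutive arcs, and at most 4|Γ|/ε + 1 arcs suffice. Since D/ε > 3, the
factor e^{5D/ε} absorbs all constants. Finally b decreases to the Bernstein index. -/

noncomputable section

namespace PlanarArg

open Filter Topology MeasureTheory Metric

/-! ## Growth of holomorphic functions in discs -/

/-- **Hadamard's three circles theorem**. -/
theorem norm_le_interp_of_mem_annulus {f : ℂ → ℂ} {c z : ℂ} {r R a b : ℝ} (hr : 0 < r)
    (hrR : r < R) (hf : AnalyticOnNhd ℂ f (closedBall c R))
    (ha : ∀ z ∈ sphere c r, ‖f z‖ ≤ a) (hb : ∀ z ∈ sphere c R, ‖f z‖ ≤ b)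
    (hz₁ : r ≤ ‖z - c‖) (hz₂ : ‖z - c‖ ≤ R) :
    ‖f z‖ ≤ a ^ (1 - Real.log (‖z - c‖ / r) / Real.log (R / r)) *
      b ^ (Real.log (‖z - c‖ / r) / Real.log (R / r)) := by
  have hR : 0 < R := hr.trans hrR
  have hzc : 0 < ‖z - c‖ := hr.trans_le hz₁
  -- The map w ↦ c + e^w carries the strip log r ≤ Re w ≤ log R onto the annulus, which reduces the
  -- claim to the three lines theorem.
  have hmaps : ∀ w ∈ Complex.HadamardThreeLines.verticalClosedStrip (Real.log r) (Real.log R),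
      c + Complex.exp w ∈ closedBall c R := by
    intro w hw
    have : w.re ≤ Real.log R := hw.2
    rw [mem_closedBall, dist_eq_norm, add_sub_cancel_left, Complex.norm_exp]
    exact (Real.le_log_iff_exp_le hR).1 this
  have hlog : Real.log r < Real.log R := Real.log_lt_log hr hrR
  have key := Complex.HadamardThreeLines.norm_le_interp_of_mem_verticalClosedStrip'
    (f := fun w => f (c + Complex.exp w)) (z := Complex.log (z - c)) (a := a) (b := b) hlog
    ?_ ?_ ?_ ?_ ?_
  · rw [Complex.exp_log (by simpa using hzc), add_sub_cancel, Complex.log_re] at key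
    rwa [Real.log_div hzc.ne' hr.ne', Real.log_div hR.ne' hr.ne']
  · exact ⟨by simpa [Complex.log_re] using Real.log_le_log hr hz₁,
      by simpa [Complex.log_re] using Real.log_le_log hzc hz₂⟩
  · refine DifferentiableOn.diffContOnCl fun w hw => ?_
    have hw' : w ∈ Complex.HadamardThreeLines.verticalClosedStrip (Real.log r) (Real.log R) := by
      refine closure_minimal (fun x hx => ?_) (isClosed_Icc.preimage Complex.continuous_re) hw
      exact ⟨hx.1.le, hx.2.le⟩
    have h1 := (hf _ (hmaps w hw')).differentiableAt
    exact (DifferentiableAt.comp w h1 (by fun_prop)).differentiableWithinAt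
  · obtain ⟨C, hC⟩ := (isCompact_closedBall c R).exists_bound_of_continuousOn hf.continuousOn
    refine ⟨C, ?_⟩
    rintro _ ⟨w, hw, rfl⟩
    exact hC _ (hmaps w hw)
  · intro w hw
    apply ha
    rw [mem_sphere, dist_eq_norm, add_sub_cancel_left, Complex.norm_exp,
      show w.re = Real.log r from hw, Real.exp_log hr]
  · intro w hw
    apply hb
    rw [mem_sphere, dist_eq_norm, add_sub_cancel_left, Complex.norm_exp,
      show w.re = Real.log R from hw, Real.exp_log hR]

/-- A lower bound for the maximum of `|f|` passes from a disc to the concentric disc of half the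
radius. -/
theorem exists_le_norm_of_mem_closedBall_two_mul {f : ℂ → ℂ} {c z : ℂ} {ρ M s : ℝ} (hρ : 0 < ρ)
    (hM : 0 < M) (hs : 0 ≤ s) (hf : AnalyticOnNhd ℂ f (closedBall c (8 * ρ)))
    (hfM : ∀ z ∈ closedBall c (8 * ρ), ‖f z‖ ≤ M) (hz : z ∈ closedBall c (2 * ρ))
    (hfz : M * Real.exp (-s) ≤ ‖f z‖) :
    ∃ z₁ ∈ closedBall c ρ, M * Real.exp (-(s * (3 / 2))) ≤ ‖f z₁‖ := by
  by_contra! hcon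
  by_cases hd : ‖z - c‖ ≤ ρ
  · have h1 := hcon z (by rwa [mem_closedBall, dist_eq_norm])
    have h2 : Real.exp (-(s * (3 / 2))) ≤ Real.exp (-s) := Real.exp_le_exp.2 (by linarith)
    nlinarith
  push Not at hd
  rw [mem_closedBall, dist_eq_norm] at hz
  -- The interpolation exponent t is at most log 2 / log 8 = 1/3. Hence (3/2)(1 - t) ≥ 1, and a
  -- maximum below M e^{-3s/2} on the small disc would force |f(z)| < M e^{-s}.
  obtain ⟨z₁, hz₁, hmax⟩ := (isCompact_closedBall c ρ).exists_isMaxOn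
    (nonempty_closedBall.2 hρ.le)
    (hf.continuousOn.mono (closedBall_subset_closedBall (by linarith))).norm
  have h3 := norm_le_interp_of_mem_annulus (z := z) (a := ‖f z₁‖) (b := M) hρ
    (by linarith : ρ < 8 * ρ) hf (fun w hw => hmax (sphere_subset_closedBall hw))
    (fun w hw => hfM w (sphere_subset_closedBall hw)) hd.le (by linarith)
  set t := Real.log (‖z - c‖ / ρ) / Real.log (8 * ρ / ρ) with ht
  have h8 : Real.log (8 * ρ / ρ) = 3 * Real.log 2 := by
    rw [mul_div_cancel_right₀ _ hρ.ne', show (8 : ℝ) = 2 ^ 3 by norm_num, Real.log_pow]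
    norm_num
  have h2pos : 0 < Real.log 2 := Real.log_pos one_lt_two
  have hdpos : 0 < ‖z - c‖ := hρ.trans hd
  have ht3 : t ≤ 1 / 3 := by
    rw [ht, h8, div_le_iff₀ (by positivity)]
    have : Real.log (‖z - c‖ / ρ) ≤ Real.log 2 :=
      Real.log_le_log (by positivity) ((div_le_iff₀ hρ).2 hz)
    linarith
  have h4 : ‖f z₁‖ ^ (1 - t) < (M * Real.exp (-(s * (3 / 2)))) ^ (1 - t) :=
    Real.rpow_lt_rpow (norm_nonneg _) (hcon z₁ hz₁) (by linarith)
  have h5 : (M * Real.exp (-(s * (3 / 2)))) ^ (1 - t) * M ^ t ≤ M * Real.exp (-s) := by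
    rw [Real.mul_rpow hM.le (Real.exp_pos _).le, mul_right_comm, ← Real.rpow_add hM,
      sub_add_cancel, Real.rpow_one, ← Real.exp_mul]
    gcongr
    nlinarith
  have h6 : 0 < M ^ t := Real.rpow_pos_of_pos hM t
  nlinarith

/-! ## Division by the zeros -/

theorem norm_prod_sub_le {S : Multiset ℂ} {c : ℂ} {ρ : ℝ} (hS : ∀ a ∈ S, a ∈ closedBall c ρ) :
    ‖(S.map fun a => c - a).prod‖ ≤ ρ ^ Multiset.card S := by
  induction S using Multiset.induction_on with
  | empty => simp
  | cons a S ih =>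
    rw [Multiset.map_cons, Multiset.prod_cons, norm_mul, Multiset.card_cons, pow_succ']
    have h1 := hS a (Multiset.mem_cons_self a S)
    rw [mem_closedBall, dist_comm, dist_eq_norm] at h1
    exact mul_le_mul h1 (ih fun b hb => hS b (Multiset.mem_cons_of_mem hb)) (norm_nonneg _)
      ((norm_nonneg _).trans h1)

theorem pow_le_norm_prod_sub {S : Multiset ℂ} {c z : ℂ} {ρ R : ℝ} (hρR : ρ ≤ R)
    (hS : ∀ a ∈ S, a ∈ closedBall c ρ) (hz : z ∈ sphere c R) :
    (R - ρ) ^ Multiset.card S ≤ ‖(S.map fun a => z - a).prod‖ := by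
  induction S using Multiset.induction_on with
  | empty => simp
  | cons a S ih =>
    rw [Multiset.map_cons, Multiset.prod_cons, norm_mul, Multiset.card_cons, pow_succ']
    have h1 := hS a (Multiset.mem_cons_self a S)
    rw [mem_closedBall] at h1
    rw [mem_sphere] at hz
    refine mul_le_mul ?_ (ih fun b hb => hS b (Multiset.mem_cons_of_mem hb))
      (pow_nonneg (by linarith) _) (norm_nonneg _)
    rw [← dist_eq_norm]
    linarith [dist_triangle z a c]

/-- A substitute for Jensen's formula. Every linear factor has modulus at least R - ρ on the outer
circle and at most ρ at the centre. By the maximum principle |g| ≤ M / (R - ρ)^n, while M e^{-s} ≤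
ρ^n |g(c)|; comparing the two gives both conclusions. -/
theorem norm_le_of_eq_prod_mul {f g : ℂ → ℂ} {c : ℂ} {ρ R M s : ℝ} {S : Multiset ℂ} (hρ : 0 < ρ)
    (hρR : 2 * ρ < R) (hM : 0 < M) (hfM : ∀ z ∈ closedBall c R, ‖f z‖ ≤ M)
    (hfc : M * Real.exp (-s) ≤ ‖f c‖) (hS : ∀ a ∈ S, a ∈ closedBall c ρ)
    (hg : AnalyticOnNhd ℂ g (closedBall c R))
    (hfg : ∀ z ∈ closedBall c R, f z = (S.map fun a => z - a).prod * g z) :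
    Multiset.card S * Real.log ((R - ρ) / ρ) ≤ s ∧
      ∀ z ∈ closedBall c R, ‖g z‖ ≤ Real.exp s * ‖g c‖ := by
  have hR : 0 < R := by linarith
  have hRρ : 0 < R - ρ := by linarith
  set n := Multiset.card S
  have hcR : c ∈ closedBall c R := mem_closedBall_self hR.le
  have h1 : ∀ z ∈ closedBall c R, ‖g z‖ ≤ M / (R - ρ) ^ n := by
    intro z hz
    refine Complex.norm_le_of_forall_mem_frontier_norm_le (U := ball c R) isBounded_ball
      (DifferentiableOn.diffContOnCl ?_) ?_ ?_
    · rw [closure_ball _ hR.ne']; exact hg.differentiableOn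
    · intro w hw
      rw [frontier_ball _ hR.ne'] at hw
      have h2 := pow_le_norm_prod_sub (by linarith : ρ ≤ R) hS hw
      have h3 := hfM w (sphere_subset_closedBall hw)
      rw [hfg w (sphere_subset_closedBall hw), norm_mul] at h3
      rw [le_div_iff₀ (by positivity)]
      calc ‖g w‖ * (R - ρ) ^ n ≤ ‖g w‖ * ‖(S.map fun a => w - a).prod‖ := by gcongr
        _ ≤ M := by rwa [mul_comm]
    · rwa [closure_ball _ hR.ne']
  have h4 : M * Real.exp (-s) ≤ ρ ^ n * ‖g c‖ := by
    refine hfc.trans ?_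
    rw [hfg c hcR, norm_mul]
    gcongr
    exact norm_prod_sub_le hS
  have h5 : M ≤ Real.exp s * (ρ ^ n * ‖g c‖) := by
    calc M = Real.exp s * (M * Real.exp (-s)) := by
          rw [mul_left_comm, ← Real.exp_add]; simp
      _ ≤ _ := by gcongr
  refine ⟨?_, fun z hz => ?_⟩
  · have h6 := h1 c hcR
    have h7 : ((R - ρ) / ρ) ^ n ≤ Real.exp s := by
      rw [div_pow, div_le_iff₀ (by positivity)]
      rw [le_div_iff₀ (by positivity)] at h6
      have hg0 : 0 < ‖g c‖ := by
        by_contra h0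
        have : ‖g c‖ = 0 := le_antisymm (not_lt.1 h0) (norm_nonneg _)
        rw [this] at h5
        linarith
      refine le_of_mul_le_mul_left ?_ hg0
      linarith
    have h8 := Real.log_le_log (by positivity) h7
    rwa [Real.log_pow, Real.log_exp] at h8
  · refine (h1 z hz).trans ?_
    rw [div_le_iff₀ (by positivity)]
    refine h5.trans ?_
    have h9 : ρ ^ n ≤ (R - ρ) ^ n := pow_le_pow_left₀ hρ.le (by linarith) n
    calc Real.exp s * (ρ ^ n * ‖g c‖) ≤ Real.exp s * ((R - ρ) ^ n * ‖g c‖) := by gcongr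
      _ = Real.exp s * ‖g c‖ * (R - ρ) ^ n := by ring

theorem AnalyticOnNhd.exists_eq_sub_mul {g : ℂ → ℂ} {K : Set ℂ} {a : ℂ}
    (hg : AnalyticOnNhd ℂ g K) (ha : a ∈ K) (hga : g a = 0) :
    ∃ g₁ : ℂ → ℂ, AnalyticOnNhd ℂ g₁ K ∧ ∀ z, g z = (z - a) * g₁ z := by
  have hV : IsOpen {z | AnalyticAt ℂ g z} := isOpen_analyticAt ℂ g
  refine ⟨dslope g a, fun z hz => ?_, fun z => ?_⟩
  · have h1 : DifferentiableOn ℂ (dslope g a) {z | AnalyticAt ℂ g z} :=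
      (Complex.differentiableOn_dslope (hV.mem_nhds (hg a ha))).2
        fun w hw => AnalyticAt.differentiableWithinAt hw
    exact h1.analyticAt (hV.mem_nhds (hg z hz))
  · have := sub_smul_dslope g a z
    rw [hga, sub_zero, smul_eq_mul] at this
    exact this.symm

/-- A holomorphic function in a disc is the product of a polynomial whose roots are its zeros in a
smaller disc and a function without zeros there; the number of zeros and the oscillation of the
second factor are controlled by the maximum of the function relative to its value at the centre. -/
theorem exists_eq_prod_mul {f : ℂ → ℂ} {c : ℂ} {ρ R M s : ℝ} (hρ : 0 < ρ)
    (hρR : 2 * ρ < R) (hM : 0 < M) (hf : AnalyticOnNhd ℂ f (closedBall c R))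
    (hfM : ∀ z ∈ closedBall c R, ‖f z‖ ≤ M) (hfc : M * Real.exp (-s) ≤ ‖f c‖) :
    ∃ (S : Multiset ℂ) (g : ℂ → ℂ), (∀ a ∈ S, a ∈ closedBall c ρ) ∧
      AnalyticOnNhd ℂ g (closedBall c R) ∧
      (∀ z ∈ closedBall c R, f z = (S.map fun a => z - a).prod * g z) ∧
      (∀ z ∈ closedBall c ρ, g z ≠ 0) ∧
      Multiset.card S * Real.log ((R - ρ) / ρ) ≤ s ∧
      ∀ z ∈ closedBall c R, ‖g z‖ ≤ Real.exp s * ‖g c‖ := by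
  by_contra! hcon
  have hsub : closedBall c ρ ⊆ closedBall c R := closedBall_subset_closedBall (by linarith)
  -- If no factorization were final, each would leave a zero of g in the small disc to divide out,
  -- so factorizations with any number n of roots would exist, against the bound on n.
  have hall : ∀ n : ℕ, ∃ (S : Multiset ℂ) (g : ℂ → ℂ), Multiset.card S = n ∧
      (∀ a ∈ S, a ∈ closedBall c ρ) ∧ AnalyticOnNhd ℂ g (closedBall c R) ∧
      (∀ z ∈ closedBall c R, f z = (S.map fun a => z - a).prod * g z) := by
    intro n
    induction n with
    | zero => exact ⟨0, f, rfl, by simp, hf, by simp⟩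
    | succ n ih =>
      obtain ⟨S, g, hn, hS, hg, hfg⟩ := ih
      have hbd := norm_le_of_eq_prod_mul hρ hρR hM hfM hfc hS hg hfg
      have hz : ∃ a ∈ closedBall c ρ, g a = 0 := by
        by_contra! h0
        obtain ⟨z, hz, hlt⟩ := hcon S g hS hg hfg h0 hbd.1
        exact absurd (hbd.2 z hz) (not_le.2 hlt)
      obtain ⟨a, ha, hga⟩ := hz
      obtain ⟨g₁, hg₁, hgg⟩ := AnalyticOnNhd.exists_eq_sub_mul hg (hsub ha) hga
      refine ⟨a ::ₘ S, g₁, by simp [hn], ?_, hg₁, fun z hz => ?_⟩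
      · intro b hb
        rcases Multiset.mem_cons.1 hb with rfl | hb
        · exact ha
        · exact hS b hb
      · rw [hfg z hz, hgg z, Multiset.map_cons, Multiset.prod_cons]
        ring
  have hL : 0 < Real.log ((R - ρ) / ρ) :=
    Real.log_pos ((one_lt_div hρ).2 (by linarith))
  obtain ⟨n, hn⟩ := exists_nat_gt (s / Real.log ((R - ρ) / ρ))
  obtain ⟨S, g, rfl, hS, hg, hfg⟩ := hall n
  have hbd := (norm_le_of_eq_prod_mul hρ hρR hM hfM hfc hS hg hfg).1
  rw [div_lt_iff₀ hL] at hn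
  linarith

theorem differentiableAt_multiset_prod_sub (S : Multiset ℂ) (z : ℂ) :
    DifferentiableAt ℂ (fun w => (S.map fun a => w - a).prod) z := by
  induction S using Multiset.induction_on with
  | empty => simp
  | cons b S ih =>
    simp only [Multiset.map_cons, Multiset.prod_cons]
    fun_prop

theorem logDeriv_multiset_prod_sub {S : Multiset ℂ} {z : ℂ} (hz : ∀ a ∈ S, z ≠ a) :
    logDeriv (fun w => (S.map fun a => w - a).prod) z = (S.map fun a => (z - a)⁻¹).sum := by
  induction S using Multiset.induction_on with
  | empty => simp
  | cons a S ih =>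
    have hS : ∀ b ∈ S, z ≠ b := fun b hb => hz b (Multiset.mem_cons_of_mem hb)
    have ha : z - a ≠ 0 := sub_ne_zero.2 (hz a (Multiset.mem_cons_self a S))
    simp only [Multiset.map_cons, Multiset.prod_cons, Multiset.sum_cons]
    rw [logDeriv_mul (f := fun w => w - a) (g := fun w => (S.map fun a => w - a).prod), ih hS]
    · simp [logDeriv_apply]
    · exact ha
    · rw [Ne, Multiset.prod_eq_zero_iff]
      simp only [Multiset.mem_map, not_exists, not_and]
      exact fun b hb h => hS b hb (sub_eq_zero.1 h)
    · fun_prop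
    · exact differentiableAt_multiset_prod_sub S z

/-! ## The logarithmic derivative of a function without zeros -/

/-- A primitive h of g'/g exists on a disc, and g e^{-h} has zero derivative, hence is constant. -/
theorem exists_log_on_ball {g : ℂ → ℂ} {c : ℂ} {ρ : ℝ} (hρ : 0 < ρ)
    (hg : DifferentiableOn ℂ g (ball c ρ)) (h0 : ∀ z ∈ ball c ρ, g z ≠ 0) :
    ∃ h : ℂ → ℂ, h c = 0 ∧ (∀ z ∈ ball c ρ, HasDerivAt h (logDeriv g z) z) ∧
      ∀ z ∈ ball c ρ, g z = g c * Complex.exp (h z) := by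
  have hd : DifferentiableOn ℂ (logDeriv g) (ball c ρ) :=
    (hg.deriv isOpen_ball).div hg h0
  obtain ⟨h, hc, hh⟩ := hd.isExactOn_ball.with_val_at c 0
  refine ⟨h, hc, hh, fun z hz => ?_⟩
  have hcm : c ∈ ball c ρ := mem_ball_self hρ
  have hgd : ∀ z ∈ ball c ρ, HasDerivAt g (deriv g z) z := fun z hz =>
    (hg.differentiableAt (isOpen_ball.mem_nhds hz)).hasDerivAt
  have hk : ∀ z ∈ ball c ρ, HasDerivAt (fun z => g z * Complex.exp (-h z)) 0 z := by
    intro z hz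
    refine ((hgd z hz).mul (hh z hz).neg.cexp).congr_deriv ?_
    have := h0 z hz
    rw [logDeriv_apply]
    field_simp
    ring
  have hconst := IsOpen.is_const_of_deriv_eq_zero isOpen_ball
    (convex_ball c ρ).isPreconnected
    (fun z hz => (hk z hz).differentiableAt.differentiableWithinAt)
    (fun z hz => (hk z hz).deriv) hz hcm
  simp only [hc, neg_zero, Complex.exp_zero, mul_one] at hconst
  rw [← hconst, mul_assoc, ← Complex.exp_add]
  simp

/-- A bound for the logarithmic derivative by Borel–Carathéodory and Cauchy. -/
theorem norm_logDeriv_le {g : ℂ → ℂ} {c z : ℂ} {ρ s : ℝ} (hρ : 0 < ρ) (hs : 0 < s)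
    (hg : DifferentiableOn ℂ g (ball c ρ)) (h0 : ∀ z ∈ ball c ρ, g z ≠ 0)
    (hgs : ∀ z ∈ ball c ρ, ‖g z‖ ≤ Real.exp s * ‖g c‖) (hz : ‖z - c‖ ≤ 2 / 3 * ρ) :
    ‖logDeriv g z‖ ≤ 60 * s / ρ := by
  obtain ⟨h, hc, hh, hgh⟩ := exists_log_on_ball hρ hg h0
  have hc0 : 0 < ‖g c‖ := norm_pos_iff.2 (h0 c (mem_ball_self hρ))
  have hball : ∀ w ∈ ball (0 : ℂ) ρ, c + w ∈ ball c ρ := by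
    intro w hw; simpa using hw
  have hre : ∀ w ∈ ball c ρ, (h w).re ≤ s := by
    intro w hw
    have h1 := hgs w hw
    rw [hgh w hw, norm_mul, Complex.norm_exp, mul_comm] at h1
    exact Real.exp_le_exp.1 (le_of_mul_le_mul_right h1 hc0)
  have hbc : ∀ w ∈ ball (0 : ℂ) ρ, ‖h (c + w)‖ ≤ 2 * s * ‖w‖ / (ρ - ‖w‖) := by
    intro w hw
    refine Complex.borelCaratheodory_zero (f := fun w => h (c + w)) hs ?_
      (fun x hx => hre _ (hball x hx)) hρ hw (by simpa using hc)
    intro x hx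
    exact (DifferentiableAt.comp x (hh _ (hball x hx)).differentiableAt
      (by fun_prop)).differentiableWithinAt
  have hsub : closedBall z (ρ / 6) ⊆ ball c ρ := by
    intro w hw
    rw [mem_closedBall] at hw
    rw [mem_ball]
    rw [← dist_eq_norm] at hz
    linarith [dist_triangle w z c]
  have hzb : z ∈ ball c ρ := hsub (mem_closedBall_self (by positivity))
  -- On the circle of radius ρ/6 about z one has |w - c| ≤ 2ρ/3 + ρ/6 = 5ρ/6, where
  -- Borel–Carathéodory gives |h| ≤ 2s · 5 = 10s. Cauchy's estimate then yields 60s/ρ.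
  have key : ‖deriv h z‖ ≤ 10 * s / (ρ / 6) := by
    refine Complex.norm_deriv_le_of_forall_mem_sphere_norm_le (by positivity) ?_ ?_
    · refine DifferentiableOn.diffContOnCl ?_
      rw [closure_ball _ (by positivity)]
      exact fun w hw => (hh w (hsub hw)).differentiableAt.differentiableWithinAt
    · intro w hw
      have hwc : ‖w - c‖ ≤ 5 / 6 * ρ := by
        rw [mem_sphere] at hw
        rw [← dist_eq_norm] at hz ⊢
        linarith [dist_triangle w z c]
      have h1 := hbc (w - c) (by rw [mem_ball_zero_iff]; linarith)
      rw [add_sub_cancel] at h1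
      refine h1.trans ?_
      rw [div_le_iff₀ (by linarith)]
      nlinarith
  rw [(hh z hzb).deriv] at key
  refine key.trans_eq ?_
  field_simp
  norm_num

/-! ## Rotation around a point and curvature -/

/-- This is the derivative of cos(arg w), namely -sin(arg w) times the rate Im(w'/w) of arg w,
without choosing a branch. -/
theorem hasDerivAt_re_div_norm {w : ℝ → ℂ} {w' : ℂ} {x : ℝ} (hw : HasDerivAt w w' x)
    (h0 : w x ≠ 0) :
    HasDerivAt (fun t => (w t).re / ‖w t‖) (-((w x).im / ‖w x‖ * (w' / w x).im)) x := by
  have hre : HasDerivAt (fun t => (w t).re) w'.re x :=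
    Complex.reCLM.hasFDerivAt.comp_hasDerivAt x hw
  have him : HasDerivAt (fun t => (w t).im) w'.im x :=
    Complex.imCLM.hasFDerivAt.comp_hasDerivAt x hw
  have hn : ‖w x‖ ≠ 0 := norm_ne_zero_iff.2 h0
  have hsq : ∀ t, (w t).re * (w t).re + (w t).im * (w t).im = ‖w t‖ ^ 2 := fun t => by
    rw [← Complex.normSq_eq_norm_sq, Complex.normSq_apply]
  have hnorm : HasDerivAt (fun t => ‖w t‖)
      (((w x).re * w'.re + (w x).im * w'.im) / ‖w x‖) x := by
    have h1 := ((hre.mul hre).add (him.mul him)).sqrt (by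
      change (w x).re * (w x).re + (w x).im * (w x).im ≠ 0
      rw [hsq]; positivity)
    refine HasDerivAt.congr_deriv (h1.congr_of_eventuallyEq (Eventually.of_forall fun t => ?_)) ?_
    · change ‖w t‖ = √((w t).re * (w t).re + (w t).im * (w t).im)
      rw [hsq, Real.sqrt_sq (norm_nonneg _)]
    · change _ / (2 * √((w x).re * (w x).re + (w x).im * (w x).im)) = _
      rw [hsq, Real.sqrt_sq (norm_nonneg _)]
      field_simp
      ring
  refine (hre.div hnorm hn).congr_deriv ?_
  have hdiv : (w' / w x).im = (w'.im * (w x).re - w'.re * (w x).im) / ‖w x‖ ^ 2 := by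
    rw [Complex.div_im, Complex.normSq_eq_norm_sq]
    ring
  rw [hdiv]
  have h2 := hsq x
  field_simp
  linear_combination (-w'.re) * h2

theorem angle_eq_arccos_re_div_norm {p v : ℂ} (hp : p ≠ 0) :
    InnerProductGeometry.angle p v = Real.arccos ((v / p).re / ‖v / p‖) := by
  rw [InnerProductGeometry.angle]
  congr 1
  by_cases hv : v = 0
  · simp [hv]
  have h1 : ‖p‖ ≠ 0 := norm_ne_zero_iff.2 hp
  have h2 : ‖v‖ ≠ 0 := norm_ne_zero_iff.2 hv
  rw [Complex.inner, Complex.div_re, Complex.normSq_eq_norm_sq, norm_div]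
  simp only [Complex.mul_re, Complex.conj_re, Complex.conj_im]
  field_simp
  ring

/-- Here q and y are cosine and sine of the oriented angle from position to velocity, k is the
turning rate of the velocity and r y the rotation rate of the position. Formally the unoriented
angle has derivative sign(y)(k - r y) ≤ |k| - |r y|. Since arccos is not differentiable at ±1, the
cosine is multiplied by c < 1; the last term is the price, and it vanishes as c → 1. -/
theorem angle_deriv_bound {c q y k r : ℝ} (hc0 : 0 < c) (hc1 : c < 1) (hr : 0 ≤ r)
    (hqy : q ^ 2 + y ^ 2 = 1) :
    -(1 / √(1 - (c * q) ^ 2)) * (c * -(y * (k - r * y))) ≤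
      |k| - |r * y| + r * (√(1 - c ^ 2) / c) := by
  set d := √(1 - c ^ 2) with hd
  have hd2 : d ^ 2 = 1 - c ^ 2 := Real.sq_sqrt (by nlinarith)
  have hd0 : 0 < d := Real.sqrt_pos.2 (by nlinarith)
  set S := √(1 - (c * q) ^ 2) with hS
  have hrad : 1 - (c * q) ^ 2 = d ^ 2 + (c * y) ^ 2 := by
    rw [hd2]; linear_combination (-c ^ 2) * hqy
  have hS2 : S ^ 2 = d ^ 2 + (c * |y|) ^ 2 := by
    rw [hS, Real.sq_sqrt (by rw [hrad]; positivity), hrad, mul_pow, mul_pow, sq_abs]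
  have hS0 : 0 < S := Real.sqrt_pos.2 (by rw [hrad]; positivity)
  have hy0 := abs_nonneg y
  have hcy : 0 ≤ c * |y| := by positivity
  have hS1 : c * |y| ≤ S := abs_le_of_sq_le_sq' (by nlinarith) hS0.le |>.2
  have hS3 : S ≤ d + c * |y| := abs_le_of_sq_le_sq' (by nlinarith) (by positivity) |>.2
  have e1 : -(1 / S) * (c * -(y * (k - r * y))) = (c * y / S) * k - r * (c * y ^ 2 / S) := by
    field_simp
  have e2 : (c * y / S) * k ≤ |k| := by
    refine (le_abs_self _).trans ?_
    rw [abs_mul, abs_div, abs_mul, abs_of_pos hc0, abs_of_pos hS0]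
    exact mul_le_of_le_one_left (abs_nonneg k) ((div_le_one hS0).2 hS1)
  -- From S ≤ d + c|y| one gets |y|S - c y² ≤ d|y|, and c|y| ≤ S bounds the right side by dS/c.
  have e3 : |y| - c * y ^ 2 / S ≤ d / c := by
    rw [← sq_abs y, sub_le_iff_le_add, div_add_div _ _ hc0.ne' hS0.ne',
      le_div_iff₀ (by positivity)]
    nlinarith [mul_le_mul_of_nonneg_left hS3 hcy, mul_le_mul_of_nonneg_left hS1 hd0.le]
  rw [e1, abs_mul, abs_of_nonneg hr]
  nlinarith [mul_le_mul_of_nonneg_left e3 hr]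

/-- Along a regular arc, the variation of the argument of the position vector is at most the total
curvature plus the decrease of the angle between the position and the velocity. -/
theorem integral_abs_im_div_add_angle_le {p v w : ℝ → ℂ} {s t : ℝ} (hst : s ≤ t)
    (hp : ContinuousOn p (Icc s t)) (hv : ContinuousOn v (Icc s t))
    (hw : ContinuousOn w (Icc s t)) (hpv : ∀ x ∈ Ioo s t, HasDerivAt p (v x) x)
    (hvw : ∀ x ∈ Ioo s t, HasDerivAt v (w x) x) (hp0 : ∀ x ∈ Icc s t, p x ≠ 0)
    (hv0 : ∀ x ∈ Icc s t, v x ≠ 0) :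
    (∫ x in s..t, |(v x / p x).im|) + InnerProductGeometry.angle (p t) (v t) ≤
      (∫ x in s..t, |(w x / v x).im|) + InnerProductGeometry.angle (p s) (v s) := by
  have hu : ContinuousOn (fun x => v x / p x) (Icc s t) := hv.div hp hp0
  have hk : ContinuousOn (fun x => w x / v x) (Icc s t) := hw.div hv hv0
  have hu0 : ∀ x ∈ Icc s t, v x / p x ≠ 0 := fun x hx => div_ne_zero (hv0 x hx) (hp0 x hx)
  have i1 : ContinuousOn (fun x => |(w x / v x).im|) (Icc s t) :=
    (Complex.continuous_im.comp_continuousOn hk).abs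
  have i2 : ContinuousOn (fun x => |(v x / p x).im|) (Icc s t) :=
    (Complex.continuous_im.comp_continuousOn hu).abs
  have i3 : ContinuousOn (fun x => ‖v x / p x‖) (Icc s t) := hu.norm
  set q : ℝ → ℝ := fun x => (v x / p x).re / ‖v x / p x‖ with hq
  have hqc : ContinuousOn q (Icc s t) :=
    (Complex.continuous_re.comp_continuousOn hu).div hu.norm fun x hx =>
      norm_ne_zero_iff.2 (hu0 x hx)
  have hsq : ∀ x ∈ Icc s t, q x ^ 2 + ((v x / p x).im / ‖v x / p x‖) ^ 2 = 1 := by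
    intro x hx
    have h1 : ‖v x / p x‖ ≠ 0 := norm_ne_zero_iff.2 (hu0 x hx)
    have h2 : (v x / p x).re * (v x / p x).re + (v x / p x).im * (v x / p x).im =
        ‖v x / p x‖ ^ 2 := by
      rw [← Complex.normSq_eq_norm_sq, Complex.normSq_apply]
    rw [hq]
    simp only [div_pow]
    rw [← add_div, div_eq_one_iff_eq (by positivity)]
    linarith
  -- Integrated form for the regularized angle arccos(c q); the limit c → 1 from below is taken at
  -- the end.
  have key : ∀ c ∈ Ioo (0 : ℝ) 1, Real.arccos (c * q t) - Real.arccos (c * q s) ≤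
      (∫ x in s..t, |(w x / v x).im|) - (∫ x in s..t, |(v x / p x).im|) +
        (∫ x in s..t, ‖v x / p x‖) * (√(1 - c ^ 2) / c) := by
    intro c hc
    have hφ : ContinuousOn (fun x => |(w x / v x).im| - |(v x / p x).im| +
        ‖v x / p x‖ * (√(1 - c ^ 2) / c)) (Icc s t) :=
      (i1.sub i2).add (i3.mul continuousOn_const)
    have h1 := intervalIntegral.sub_le_integral_of_hasDeriv_right_of_le (a := s) (b := t)
      (g := fun x => Real.arccos (c * q x))
      (g' := fun x => -(1 / √(1 - (c * q x) ^ 2)) * (c * -((v x / p x).im / ‖v x / p x‖ *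
        ((w x / v x).im - ‖v x / p x‖ * ((v x / p x).im / ‖v x / p x‖)))))
      (φ := fun x => |(w x / v x).im| - |(v x / p x).im| + ‖v x / p x‖ * (√(1 - c ^ 2) / c))
      hst (Real.continuous_arccos.comp_continuousOn (continuousOn_const.mul hqc)) ?_
      (hφ.integrableOn_Icc) ?_
    · refine h1.trans_eq ?_
      have j1 := i1.intervalIntegrable_of_Icc hst (μ := volume)
      have j2 := i2.intervalIntegrable_of_Icc hst (μ := volume)
      have j3 := i3.intervalIntegrable_of_Icc hst (μ := volume)
      rw [intervalIntegral.integral_add (j1.sub j2) (j3.mul_const _),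
        intervalIntegral.integral_sub j1 j2, intervalIntegral.integral_mul_const]
    · intro x hx
      have hx' := Ioo_subset_Icc_self hx
      have hn : ‖v x / p x‖ ≠ 0 := norm_ne_zero_iff.2 (hu0 x hx')
      -- The logarithmic derivative of v/p is w/v - v/p: the oriented angle changes at the turning
      -- rate of the velocity minus the rotation rate of the position.
      have hdu : HasDerivAt (fun y => v y / p y)
          (v x / p x * (w x / v x - v x / p x)) x := by
        refine ((hvw x hx).div (hpv x hx) (hp0 x hx')).congr_deriv ?_
        have := hp0 x hx'
        have := hv0 x hx'
        field_simp
      have hdq := hasDerivAt_re_div_norm hdu (hu0 x hx')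
      have hq1 : |q x| ≤ 1 := by
        rw [abs_le_one_iff_mul_self_le_one]
        nlinarith [hsq x hx', sq_nonneg ((v x / p x).im / ‖v x / p x‖)]
      have hcq : |c * q x| < 1 := by
        rw [abs_mul, abs_of_pos hc.1]
        nlinarith [hc.1, hc.2, abs_nonneg (q x)]
      have hda := (Real.hasDerivAt_arccos (x := c * q x) (by linarith [(abs_lt.1 hcq).1])
        (by linarith [(abs_lt.1 hcq).2])).comp x (hdq.const_mul c)
      refine (hda.congr_deriv ?_).hasDerivWithinAt
      rw [mul_div_cancel_left₀ _ (hu0 x hx'), mul_div_cancel₀ _ hn, Complex.sub_im]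
    · intro x hx
      have hx' := Ioo_subset_Icc_self hx
      have hn : ‖v x / p x‖ ≠ 0 := norm_ne_zero_iff.2 (hu0 x hx')
      have := angle_deriv_bound (k := (w x / v x).im) hc.1 hc.2 (norm_nonneg (v x / p x))
        (hsq x hx')
      refine this.trans_eq ?_
      rw [mul_div_cancel₀ _ hn]
  have hlim : ∀ y : ℝ, Tendsto (fun c => Real.arccos (c * y)) (𝓝[<] 1) (𝓝 (Real.arccos y)) := by
    intro y
    have : Continuous fun c : ℝ => Real.arccos (c * y) :=
      Real.continuous_arccos.comp (continuous_id.mul continuous_const)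
    simpa using (this.tendsto 1).mono_left nhdsWithin_le_nhds
  have hlim2 : Tendsto (fun c : ℝ => √(1 - c ^ 2) / c) (𝓝[<] 1) (𝓝 0) := by
    have : ContinuousAt (fun c : ℝ => √(1 - c ^ 2) / c) 1 :=
      ContinuousAt.div (by fun_prop) continuousAt_id one_ne_zero
    simpa using this.tendsto.mono_left nhdsWithin_le_nhds
  have hfin := le_of_tendsto_of_tendsto ((hlim (q t)).sub (hlim (q s)))
    ((tendsto_const_nhds (x := (∫ x in s..t, |(w x / v x).im|) -
      (∫ x in s..t, |(v x / p x).im|))).add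
        ((tendsto_const_nhds (x := ∫ x in s..t, ‖v x / p x‖)).mul hlim2))
    (by
      filter_upwards [Ioo_mem_nhdsLT (zero_lt_one' ℝ)] with c hc using key c hc)
  rw [angle_eq_arccos_re_div_norm (hp0 t (right_mem_Icc.2 hst)),
    angle_eq_arccos_re_div_norm (hp0 s (left_mem_Icc.2 hst))]
  simp only [mul_zero, add_zero] at hfin
  linarith

namespace PiecewiseSmoothCurve

variable (Γ : PiecewiseSmoothCurve)

/-! ## Piecewise smooth curves -/

theorem node_mono {i j : ℕ} (hij : i ≤ j) (hj : j ≤ Γ.numPieces) : Γ.node i ≤ Γ.node j := by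
  induction j, hij using Nat.le_induction with
  | base => exact le_rfl
  | succ j _ ih => exact (ih (by omega)).trans (Γ.node_lt j (by omega)).le

theorem node_mem {i : ℕ} (hi : i ≤ Γ.numPieces) : Γ.node i ∈ Icc (0 : ℝ) 1 :=
  ⟨Γ.node_zero ▸ Γ.node_mono (Nat.zero_le i) hi, Γ.node_last ▸ Γ.node_mono hi le_rfl⟩

theorem numPieces_pos : 0 < Γ.numPieces := by
  by_contra h
  have h1 := Γ.node_last
  rw [show Γ.numPieces = 0 by omega, Γ.node_zero] at h1
  norm_num at h1

theorem exists_mem_piece {t : ℝ} (ht : t ∈ Ico (0 : ℝ) 1) :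
    ∃ i < Γ.numPieces, t ∈ Ico (Γ.node i) (Γ.node (i + 1)) := by
  have h : ∀ m ≤ Γ.numPieces, t < Γ.node m →
      ∃ i < Γ.numPieces, t ∈ Ico (Γ.node i) (Γ.node (i + 1)) := by
    intro m
    induction m with
    | zero => intro _ h; rw [Γ.node_zero] at h; exact absurd ht.1 (not_le.2 h)
    | succ m ih =>
      intro hm h
      by_cases h' : t < Γ.node m
      · exact ih (by omega) h'
      · exact ⟨m, by omega, not_lt.1 h', h⟩
  exact h Γ.numPieces le_rfl (Γ.node_last ▸ ht.2)

/-- The set of subdivision points. -/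
def nodes : Set ℝ := Γ.node '' Iic Γ.numPieces

theorem countable_nodes : Γ.nodes.Countable := (Set.finite_Iic _).countable.image _

theorem exists_mem_interior_piece {t : ℝ} (ht : t ∈ Ioo (0 : ℝ) 1) (htn : t ∉ Γ.nodes) :
    ∃ i < Γ.numPieces, t ∈ Ioo (Γ.node i) (Γ.node (i + 1)) := by
  obtain ⟨i, hi, h⟩ := Γ.exists_mem_piece ⟨ht.1.le, ht.2⟩
  refine ⟨i, hi, lt_of_le_of_ne h.1 fun he => htn ⟨i, hi.le, he⟩, h.2⟩

variable {Γ} {i : ℕ}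

theorem uniqueDiffOn_piece (hi : i < Γ.numPieces) : UniqueDiffOn ℝ (Γ.piece i) :=
  uniqueDiffOn_Icc (Γ.node_lt i hi)

theorem piece_subset (hi : i < Γ.numPieces) : Γ.piece i ⊆ Icc 0 1 :=
  Icc_subset_Icc (Γ.node_mem hi.le).1 (Γ.node_mem hi).2

theorem contDiffOn_velocity (hi : i < Γ.numPieces) :
    ContDiffOn ℝ 1 (Γ.velocity i) (Γ.piece i) :=
  (Γ.contDiffOn i hi).derivWithin (uniqueDiffOn_piece hi) (by norm_num)

theorem continuousOn_velocity (hi : i < Γ.numPieces) :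
    ContinuousOn (Γ.velocity i) (Γ.piece i) :=
  (contDiffOn_velocity hi).continuousOn

theorem continuousOn_acceleration (hi : i < Γ.numPieces) :
    ContinuousOn (Γ.acceleration i) (Γ.piece i) :=
  (contDiffOn_velocity hi).continuousOn_derivWithin (uniqueDiffOn_piece hi) le_rfl

theorem hasDerivAt_velocity (hi : i < Γ.numPieces) {x : ℝ}
    (hx : x ∈ Ioo (Γ.node i) (Γ.node (i + 1))) : HasDerivAt Γ.toFun (Γ.velocity i x) x :=
  (((Γ.contDiffOn i hi).differentiableOn (by norm_num) x
    (Ioo_subset_Icc_self hx)).hasDerivWithinAt).hasDerivAt (Icc_mem_nhds hx.1 hx.2)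

theorem hasDerivAt_acceleration (hi : i < Γ.numPieces) {x : ℝ}
    (hx : x ∈ Ioo (Γ.node i) (Γ.node (i + 1))) :
    HasDerivAt (Γ.velocity i) (Γ.acceleration i x) x :=
  (((contDiffOn_velocity hi).differentiableOn (by norm_num) x
    (Ioo_subset_Icc_self hx)).hasDerivWithinAt).hasDerivAt (Icc_mem_nhds hx.1 hx.2)

theorem deriv_eq_velocity (hi : i < Γ.numPieces) :
    EqOn (deriv Γ.toFun) (Γ.velocity i) (Ioo (Γ.node i) (Γ.node (i + 1))) :=
  fun _ hx => (hasDerivAt_velocity hi hx).deriv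

theorem deriv_deriv_eq_acceleration (hi : i < Γ.numPieces) :
    EqOn (deriv (deriv Γ.toFun)) (Γ.acceleration i) (Ioo (Γ.node i) (Γ.node (i + 1))) := by
  intro x hx
  rw [(eventuallyEq_of_mem (isOpen_Ioo.mem_nhds hx) (deriv_eq_velocity hi)).deriv_eq]
  exact (hasDerivAt_acceleration hi hx).deriv

variable (Γ) in
/-- The curvature with respect to the parameter (the rate of turning of the tangent). -/
def turning (x : ℝ) : ℝ := |(deriv (deriv Γ.toFun) x / deriv Γ.toFun x).im|

theorem turning_eq (hi : i < Γ.numPieces) :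
    EqOn Γ.turning (fun x => |(Γ.acceleration i x / Γ.velocity i x).im|)
      (Ioo (Γ.node i) (Γ.node (i + 1))) := by
  intro x hx
  simp only [turning]
  rw [deriv_eq_velocity hi hx, deriv_deriv_eq_acceleration hi hx]

/-- Both sides are the speed at which the direction of the velocity turns. -/
theorem curvature_mul_norm_velocity (hi : i < Γ.numPieces) {x : ℝ} (hx : x ∈ Γ.piece i) :
    Γ.curvature i x * ‖Γ.velocity i x‖ = |(Γ.acceleration i x / Γ.velocity i x).im| := by
  have h0 : ‖Γ.velocity i x‖ ≠ 0 := norm_ne_zero_iff.2 (Γ.regular i hi x hx)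
  have h1 : (Γ.acceleration i x / Γ.velocity i x).im =
      ((Γ.velocity i x).re * (Γ.acceleration i x).im -
        (Γ.velocity i x).im * (Γ.acceleration i x).re) / ‖Γ.velocity i x‖ ^ 2 := by
    rw [Complex.div_im, Complex.normSq_eq_norm_sq]
    ring
  rw [h1, abs_div, abs_of_nonneg (by positivity : 0 ≤ ‖Γ.velocity i x‖ ^ 2), curvature]
  field_simp

theorem continuousOn_abs_im_div (hi : i < Γ.numPieces) :
    ContinuousOn (fun x => |(Γ.acceleration i x / Γ.velocity i x).im|) (Γ.piece i) :=
  (Complex.continuous_im.comp_continuousOn ((continuousOn_acceleration hi).div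
    (continuousOn_velocity hi) (Γ.regular i hi))).abs

theorem intervalIntegrable_deriv_piece (hi : i < Γ.numPieces) :
    IntervalIntegrable (deriv Γ.toFun) volume (Γ.node i) (Γ.node (i + 1)) := by
  have hle := (Γ.node_lt i hi).le
  refine IntervalIntegrable.congr_uIoo
    ((continuousOn_velocity hi).intervalIntegrable_of_Icc hle) ?_
  rw [uIoo_of_le hle]
  exact (deriv_eq_velocity hi).symm

theorem intervalIntegrable_turning_piece (hi : i < Γ.numPieces) :
    IntervalIntegrable Γ.turning volume (Γ.node i) (Γ.node (i + 1)) := by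
  have hle := (Γ.node_lt i hi).le
  refine IntervalIntegrable.congr_uIoo
    ((continuousOn_abs_im_div hi).intervalIntegrable_of_Icc hle) ?_
  rw [uIoo_of_le hle]
  exact (turning_eq hi).symm

theorem intervalIntegrable_deriv {s t : ℝ} (hs : s ∈ Icc (0 : ℝ) 1) (ht : t ∈ Icc (0 : ℝ) 1) :
    IntervalIntegrable (deriv Γ.toFun) volume s t := by
  have h := IntervalIntegrable.trans_iterate (a := Γ.node) (n := Γ.numPieces)
    (f := deriv Γ.toFun) (μ := volume) fun k hk => intervalIntegrable_deriv_piece hk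
  rw [Γ.node_zero, Γ.node_last] at h
  exact h.mono_set (by rw [uIcc_of_le zero_le_one]; exact uIcc_subset_Icc hs ht)

theorem intervalIntegrable_turning {s t : ℝ} (hs : s ∈ Icc (0 : ℝ) 1)
    (ht : t ∈ Icc (0 : ℝ) 1) : IntervalIntegrable Γ.turning volume s t := by
  have h := IntervalIntegrable.trans_iterate (a := Γ.node) (n := Γ.numPieces)
    (f := Γ.turning) (μ := volume) fun k hk => intervalIntegrable_turning_piece hk
  rw [Γ.node_zero, Γ.node_last] at h
  exact h.mono_set (by rw [uIcc_of_le zero_le_one]; exact uIcc_subset_Icc hs ht)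

theorem length_eq : Γ.length = ∫ x in (0 : ℝ)..1, ‖deriv Γ.toFun x‖ := by
  have h := intervalIntegral.sum_integral_adjacent_intervals (a := Γ.node) (n := Γ.numPieces)
    (f := fun x => ‖deriv Γ.toFun x‖) (μ := volume)
    fun k hk => (intervalIntegrable_deriv_piece hk).norm
  rw [Γ.node_zero, Γ.node_last] at h
  rw [← h, length]
  refine Finset.sum_congr rfl fun i hi => ?_
  have hi := Finset.mem_range.1 hi
  refine intervalIntegral.integral_congr_Ioo_of_le (Γ.node_lt i hi).le fun x hx => ?_
  simp only [deriv_eq_velocity hi hx]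

/-! ### Accumulated curvature and rotation around a point -/

variable (Γ) in
/-- The exterior angle at the end of the `j`-th piece. -/
def exteriorAngle (j : ℕ) : ℝ :=
  InnerProductGeometry.angle (Γ.velocity j (Γ.node (j + 1))) (Γ.velocity (j + 1) (Γ.node (j + 1)))

variable (Γ) in
/-- The total curvature of the part of the curve with parameters at most `t`. -/
def curvatureUpTo (t : ℝ) : ℝ :=
  (∫ x in (0 : ℝ)..t, Γ.turning x) +
    ∑ j ∈ Finset.range (Γ.numPieces - 1), if Γ.node (j + 1) ≤ t then Γ.exteriorAngle j else 0

theorem exteriorAngle_nonneg (j : ℕ) : 0 ≤ Γ.exteriorAngle j :=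
  InnerProductGeometry.angle_nonneg _ _

theorem curvatureUpTo_zero : Γ.curvatureUpTo 0 = 0 := by
  rw [curvatureUpTo, intervalIntegral.integral_same, zero_add]
  refine Finset.sum_eq_zero fun j hj => if_neg ?_
  have hj := Finset.mem_range.1 hj
  have h1 := Γ.node_lt j (by omega)
  have h2 := (Γ.node_mem (i := j) (by omega)).1
  linarith

theorem curvatureUpTo_one : Γ.curvatureUpTo 1 = Γ.totalCurvature := by
  rw [curvatureUpTo, totalCurvature]
  congr 1
  · have h := intervalIntegral.sum_integral_adjacent_intervals (a := Γ.node) (n := Γ.numPieces)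
      (f := Γ.turning) (μ := volume) fun k hk => intervalIntegrable_turning_piece hk
    rw [Γ.node_zero, Γ.node_last] at h
    rw [← h]
    refine Finset.sum_congr rfl fun i hi => ?_
    have hi := Finset.mem_range.1 hi
    refine intervalIntegral.integral_congr_Ioo_of_le (Γ.node_lt i hi).le fun x hx => ?_
    rw [turning_eq hi hx]
    exact (curvature_mul_norm_velocity hi (Ioo_subset_Icc_self hx)).symm
  · refine Finset.sum_congr rfl fun j hj => ?_
    have hj := Finset.mem_range.1 hj
    rw [if_pos (Γ.node_mem (i := j + 1) (by omega)).2, exteriorAngle]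

theorem totalCurvature_nonneg : 0 ≤ Γ.totalCurvature := by
  rw [← curvatureUpTo_one, curvatureUpTo]
  refine add_nonneg (intervalIntegral.integral_nonneg zero_le_one fun x _ => abs_nonneg _)
    (Finset.sum_nonneg fun j _ => ?_)
  split_ifs
  exacts [exteriorAngle_nonneg j, le_rfl]

theorem length_nonneg : 0 ≤ Γ.length := by
  rw [length_eq]
  exact intervalIntegral.integral_nonneg zero_le_one fun x _ => norm_nonneg _

theorem intervalIntegrable_mul_deriv {h : ℝ → ℂ} {s t : ℝ} (hs : s ∈ Icc (0 : ℝ) 1)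
    (ht : t ∈ Icc (0 : ℝ) 1) (hh : ContinuousOn h (uIcc s t)) :
    IntervalIntegrable (fun x => h x * deriv Γ.toFun x) volume s t :=
  (intervalIntegrable_deriv hs ht).continuousOn_mul hh

theorem intervalIntegrable_abs_im_mul_deriv {h : ℝ → ℂ} {s t : ℝ} (hs : s ∈ Icc (0 : ℝ) 1)
    (ht : t ∈ Icc (0 : ℝ) 1) (hh : ContinuousOn h (uIcc s t)) :
    IntervalIntegrable (fun x => |(h x * deriv Γ.toFun x).im|) volume s t := by
  have h1 := Γ.intervalIntegrable_mul_deriv hs ht hh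
  have h2 : IntervalIntegrable (fun x => (h x * deriv Γ.toFun x).im) volume s t :=
    ⟨h1.1.im, h1.2.im⟩
  exact h2.abs

theorem continuousOn_inv_sub {a : ℂ} {s t : ℝ} (hs : 0 ≤ s) (ht : t ≤ 1)
    (ha : ∀ x ∈ Icc s t, Γ.toFun x ≠ a) :
    ContinuousOn (fun x => (Γ.toFun x - a)⁻¹) (Icc s t) :=
  ((Γ.continuousOn.mono (Icc_subset_Icc hs ht)).sub continuousOn_const).inv₀
    fun x hx => sub_ne_zero.2 (ha x hx)

theorem integral_abs_im_piece_le (hi : i < Γ.numPieces) {a : ℂ} {s t : ℝ} (hs : Γ.node i ≤ s)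
    (hst : s ≤ t) (ht : t ≤ Γ.node (i + 1)) (ha : ∀ x ∈ Icc s t, Γ.toFun x ≠ a) :
    (∫ x in s..t, |((Γ.toFun x - a)⁻¹ * deriv Γ.toFun x).im|) +
        InnerProductGeometry.angle (Γ.toFun t - a) (Γ.velocity i t) ≤
      (∫ x in s..t, Γ.turning x) +
        InnerProductGeometry.angle (Γ.toFun s - a) (Γ.velocity i s) := by
  have hsub : Icc s t ⊆ Γ.piece i := Icc_subset_Icc hs ht
  have hsub' : Ioo s t ⊆ Ioo (Γ.node i) (Γ.node (i + 1)) := Ioo_subset_Ioo hs ht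
  have key := integral_abs_im_div_add_angle_le (p := fun x => Γ.toFun x - a)
    (v := Γ.velocity i) (w := Γ.acceleration i) hst
    ((Γ.continuousOn.mono (hsub.trans (piece_subset hi))).sub continuousOn_const)
    ((continuousOn_velocity hi).mono hsub) ((continuousOn_acceleration hi).mono hsub)
    (fun x hx => (hasDerivAt_velocity hi (hsub' hx)).sub_const a)
    (fun x hx => hasDerivAt_acceleration hi (hsub' hx))
    (fun x hx => sub_ne_zero.2 (ha x hx)) (fun x hx => Γ.regular i hi x (hsub hx))
  have e1 : ∫ x in s..t, |((Γ.toFun x - a)⁻¹ * deriv Γ.toFun x).im| =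
      ∫ x in s..t, |(Γ.velocity i x / (Γ.toFun x - a)).im| :=
    intervalIntegral.integral_congr_Ioo_of_le hst fun x hx => by
      simp only [deriv_eq_velocity hi (hsub' hx), div_eq_inv_mul]
  have e2 : ∫ x in s..t, Γ.turning x =
      ∫ x in s..t, |(Γ.acceleration i x / Γ.velocity i x).im| :=
    intervalIntegral.integral_congr_Ioo_of_le hst fun x hx => turning_eq hi (hsub' hx)
  rwa [e1, e2]

/-- Induction over the pieces: at a node the triangle inequality for angles lets the angle between
position and velocity grow by at most the exterior angle, so the smooth estimates chain. -/
theorem integral_abs_im_add_angle_le {i₀ : ℕ} {a : ℂ} {s : ℝ} (hs : s ∈ Γ.piece i₀) (hij : i₀ ≤ i)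
    (hi : i < Γ.numPieces) {t : ℝ} (ht : t ∈ Γ.piece i) (hst : s ≤ t)
    (ha : ∀ x ∈ Icc s t, Γ.toFun x ≠ a) :
    (∫ x in s..t, |((Γ.toFun x - a)⁻¹ * deriv Γ.toFun x).im|) +
        InnerProductGeometry.angle (Γ.toFun t - a) (Γ.velocity i t) ≤
      (∫ x in s..t, Γ.turning x) + ∑ j ∈ Finset.Ico i₀ i, Γ.exteriorAngle j +
        InnerProductGeometry.angle (Γ.toFun s - a) (Γ.velocity i₀ s) := by
  induction i, hij using Nat.le_induction generalizing t with
  | base => simpa using integral_abs_im_piece_le hi hs.1 hst ht.2 ha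
  | succ i hij ih =>
    have hi' : i < Γ.numPieces := by omega
    set m := Γ.node (i + 1) with hm
    have hmI : m ∈ Icc (0 : ℝ) 1 := Γ.node_mem hi'
    have hsI : s ∈ Icc (0 : ℝ) 1 := piece_subset (by omega) hs
    have htI : t ∈ Icc (0 : ℝ) 1 := piece_subset hi ht
    have hsm : s ≤ m := hs.2.trans (Γ.node_mono (by omega) (by omega))
    have hmt : m ≤ t := ht.1
    have h1 := ih hi' ⟨(Γ.node_lt i hi').le, le_rfl⟩ hsm
      (fun x hx => ha x ⟨hx.1, hx.2.trans hmt⟩)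
    have h2 := integral_abs_im_piece_le hi le_rfl hmt ht.2
      (fun x hx => ha x ⟨hsm.trans hx.1, hx.2⟩)
    have h3 := InnerProductGeometry.angle_le_angle_add_angle (Γ.toFun m - a) (Γ.velocity i m)
      (Γ.velocity (i + 1) m)
    have hc : ContinuousOn (fun x => (Γ.toFun x - a)⁻¹) (Icc s t) :=
      continuousOn_inv_sub hsI.1 htI.2 ha
    rw [Finset.sum_Ico_succ_top hij, ← intervalIntegral.integral_add_adjacent_intervals
        (Γ.intervalIntegrable_turning hsI hmI) (Γ.intervalIntegrable_turning hmI htI),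
      ← intervalIntegral.integral_add_adjacent_intervals
        (Γ.intervalIntegrable_abs_im_mul_deriv hsI hmI (hc.mono (by
          rw [uIcc_of_le hsm]; exact Icc_subset_Icc_right hmt)))
        (Γ.intervalIntegrable_abs_im_mul_deriv hmI htI (hc.mono (by
          rw [uIcc_of_le hmt]; exact Icc_subset_Icc_left hsm)))]
    have h4 : Γ.exteriorAngle i =
      InnerProductGeometry.angle (Γ.velocity i m) (Γ.velocity (i + 1) m) := rfl
    linarith

/-- The variation of the argument of `Γ - a` along an arc is at most the total curvature of the arc
plus `π`. -/
theorem integral_abs_im_le {a : ℂ} {s t : ℝ} (hs : 0 ≤ s) (hst : s ≤ t) (ht : t ≤ 1)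
    (ha : ∀ x ∈ Icc s t, Γ.toFun x ≠ a) :
    ∫ x in s..t, |((Γ.toFun x - a)⁻¹ * deriv Γ.toFun x).im| ≤
      Γ.curvatureUpTo t - Γ.curvatureUpTo s + Real.pi := by
  have hsI : s ∈ Icc (0 : ℝ) 1 := ⟨hs, hst.trans ht⟩
  have htI : t ∈ Icc (0 : ℝ) 1 := ⟨hs.trans hst, ht⟩
  -- The piece of s is taken half-open on the right, so that a corner located at s is not counted
  -- again; s = 1 lies in no such piece, but then the arc is a point.
  rcases hsI.2.eq_or_lt with rfl | hs1
  · obtain rfl : t = 1 := le_antisymm ht hst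
    simpa using Real.pi_pos.le
  obtain ⟨i₀, hi₀, hsi⟩ := Γ.exists_mem_piece ⟨hs, hs1⟩
  have hfind : ∃ i, i₀ ≤ i ∧ i < Γ.numPieces ∧ t ∈ Γ.piece i := by
    rcases ht.eq_or_lt with rfl | ht1
    · have h0 := Γ.numPieces_pos
      refine ⟨Γ.numPieces - 1, by omega, by omega, (Γ.node_mem (by omega)).2, ?_⟩
      rw [Nat.sub_add_cancel h0, Γ.node_last]
    · obtain ⟨i, hi, hti⟩ := Γ.exists_mem_piece ⟨htI.1, ht1⟩
      refine ⟨i, ?_, hi, hti.1, hti.2.le⟩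
      by_contra! hlt
      have := Γ.node_mono (i := i + 1) (j := i₀) hlt hi₀.le
      linarith [hsi.1, hti.2]
  obtain ⟨i, hii, hi, hti⟩ := hfind
  have h1 := integral_abs_im_add_angle_le ⟨hsi.1, hsi.2.le⟩ hii hi hti hst ha
  have h2 := InnerProductGeometry.angle_nonneg (Γ.toFun t - a) (Γ.velocity i t)
  have h3 := InnerProductGeometry.angle_le_pi (Γ.toFun s - a) (Γ.velocity i₀ s)
  -- The corners met satisfy s < `Γ.node (j + 1)` ≤ t, which are exactly among those counted by the
  -- difference of the two accumulated sums.
  have h4 : ∑ j ∈ Finset.Ico i₀ i, Γ.exteriorAngle j ≤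
      ∑ j ∈ Finset.range (Γ.numPieces - 1),
        ((if Γ.node (j + 1) ≤ t then Γ.exteriorAngle j else 0) -
          if Γ.node (j + 1) ≤ s then Γ.exteriorAngle j else 0) := by
    refine (Finset.sum_le_sum fun j hj => ?_).trans
      (Finset.sum_le_sum_of_subset_of_nonneg (s := Finset.Ico i₀ i) ?_ fun j _ _ => ?_)
    · have hj := Finset.mem_Ico.1 hj
      rw [if_pos ((Γ.node_mono (by omega) hi.le).trans hti.1), if_neg, sub_zero]
      exact not_le.2 (hsi.2.trans_le (Γ.node_mono (by omega) (by omega)))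
    · intro j hj
      have hj := Finset.mem_Ico.1 hj
      exact Finset.mem_range.2 (by omega)
    · have h0 := Γ.exteriorAngle_nonneg j
      split_ifs with h5 h6 h6
      · simp
      · simpa using h0
      · exact absurd (h6.trans hst) h5
      · simp
  rw [Finset.sum_sub_distrib] at h4
  have h5 := intervalIntegral.integral_add_adjacent_intervals
    (Γ.intervalIntegrable_turning ⟨le_rfl, zero_le_one⟩ hsI)
    (Γ.intervalIntegrable_turning hsI htI)
  simp only [curvatureUpTo]
  linarith

theorem norm_sub_le_integral {s t : ℝ} (hs : 0 ≤ s) (hst : s ≤ t) (ht : t ≤ 1) :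
    ‖Γ.toFun t - Γ.toFun s‖ ≤ ∫ x in s..t, ‖deriv Γ.toFun x‖ := by
  rw [← integral_eq_of_hasDerivAt_off_countable_of_le Γ.toFun (deriv Γ.toFun) hst
    Γ.countable_nodes (Γ.continuousOn.mono (Icc_subset_Icc hs ht)) ?_
    (Γ.intervalIntegrable_deriv ⟨hs, hst.trans ht⟩ ⟨hs.trans hst, ht⟩)]
  · exact intervalIntegral.norm_integral_le_integral_norm hst
  · intro x hx
    obtain ⟨i, hi, hxi⟩ := Γ.exists_mem_interior_piece
      ⟨hs.trans_lt hx.1.1, hx.1.2.trans_le ht⟩ hx.2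
    exact (hasDerivAt_velocity hi hxi).differentiableAt.hasDerivAt

end PiecewiseSmoothCurve

/-! ## The variation of argument as an integral -/

theorem eVariationOn_le_of_abs_sub_le {φ Φ : ℝ → ℝ} {a b : ℝ} (hab : a ≤ b)
    (h : ∀ x ∈ Icc a b, ∀ y ∈ Icc a b, x ≤ y → |φ y - φ x| ≤ Φ y - Φ x) :
    eVariationOn φ (Icc a b) ≤ ENNReal.ofReal (Φ b - Φ a) := by
  have hmono : MonotoneOn Φ (Icc a b) := fun x hx y hy hxy =>
    sub_nonneg.1 ((abs_nonneg _).trans (h x hx y hy hxy))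
  have h1 := hmono.eVariationOn_eq (left_mem_Icc.2 hab) (right_mem_Icc.2 hab)
  rw [inter_self] at h1
  rw [← h1]
  refine iSup_le fun ⟨n, u, hu, hus⟩ => le_trans (Finset.sum_le_sum fun i _ => ?_)
    (eVariationOn.sum_le (f := Φ) (n := n) hu hus)
  have h2 := h _ (hus i) _ (hus (i + 1)) (hu i.le_succ)
  rw [edist_dist, edist_dist, Real.dist_eq, Real.dist_eq]
  exact ENNReal.ofReal_le_ofReal (h2.trans (le_abs_self _))

namespace PiecewiseSmoothCurve

variable {Γ : PiecewiseSmoothCurve}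

theorem mem_trace {t : ℝ} (ht : t ∈ Icc (0 : ℝ) 1) : Γ.toFun t ∈ Γ.trace := mem_image_of_mem _ ht

theorem continuousOn_logDeriv_comp {f : ℂ → ℂ} (hf : AnalyticOnNhd ℂ f Γ.trace)
    (h0 : ∀ z ∈ Γ.trace, f z ≠ 0) :
    ContinuousOn (fun x => logDeriv f (Γ.toFun x)) (Icc 0 1) := by
  have h1 : ContinuousOn (logDeriv f) Γ.trace :=
    hf.deriv.continuousOn.div hf.continuousOn h0
  exact h1.comp Γ.continuousOn fun x hx => mem_trace hx

/-- The product of f ∘ Γ with the exponential of minus the integral is continuous and has derivative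
zero off the finitely many nodes, hence is constant. -/
theorem comp_eq_mul_exp_integral {f : ℂ → ℂ} (hf : AnalyticOnNhd ℂ f Γ.trace)
    (h0 : ∀ z ∈ Γ.trace, f z ≠ 0) {t : ℝ} (ht : t ∈ Icc (0 : ℝ) 1) :
    f (Γ.toFun t) = f (Γ.toFun 0) *
      Complex.exp (∫ x in (0 : ℝ)..t, logDeriv f (Γ.toFun x) * deriv Γ.toFun x) := by
  have hu : uIcc (0 : ℝ) 1 = Icc 0 1 := uIcc_of_le zero_le_one
  have hL := continuousOn_logDeriv_comp hf h0
  have hint := Γ.intervalIntegrable_mul_deriv ⟨le_rfl, zero_le_one⟩ ⟨zero_le_one, le_rfl⟩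
    (h := fun x => logDeriv f (Γ.toFun x)) (by rwa [hu])
  set G : ℝ → ℂ := fun x => logDeriv f (Γ.toFun x) * deriv Γ.toFun x with hG
  set E : ℝ → ℂ := fun t => ∫ x in (0 : ℝ)..t, G x with hE
  have hEc : ContinuousOn E (Icc 0 1) := by
    have := intervalIntegral.continuousOn_primitive_interval' hint left_mem_uIcc
    rwa [hu] at this
  have hfc : ContinuousOn (fun x => f (Γ.toFun x)) (Icc 0 1) :=
    hf.continuousOn.comp Γ.continuousOn fun x hx => mem_trace hx
  have hcont : ContinuousOn (fun x => f (Γ.toFun x) * Complex.exp (-E x)) (Icc 0 1) :=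
    hfc.mul (Complex.continuous_exp.comp_continuousOn hEc.neg)
  have hder : ∀ x ∈ Ioo (0 : ℝ) t \ Γ.nodes,
      HasDerivAt (fun x => f (Γ.toFun x) * Complex.exp (-E x)) 0 x := by
    intro x hx
    have hx01 : x ∈ Ioo (0 : ℝ) 1 := ⟨hx.1.1, hx.1.2.trans_le ht.2⟩
    have hxI := Ioo_subset_Icc_self hx01
    obtain ⟨i, hi, hxi⟩ := Γ.exists_mem_interior_piece hx01 hx.2
    have hsub : Ioo (Γ.node i) (Γ.node (i + 1)) ⊆ Icc 0 1 :=
      Ioo_subset_Icc_self.trans (piece_subset hi)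
    have hdc : ContinuousOn G (Ioo (Γ.node i) (Γ.node (i + 1))) :=
      (hL.mono hsub).mul (((continuousOn_velocity hi).mono Ioo_subset_Icc_self).congr
        (deriv_eq_velocity hi))
    have hEd : HasDerivAt E (G x) x := by
      refine intervalIntegral.integral_hasDerivAt_right (hint.mono_set ?_)
        (hdc.stronglyMeasurableAtFilter isOpen_Ioo x hxi)
        (hdc.continuousAt (isOpen_Ioo.mem_nhds hxi))
      exact uIcc_subset_uIcc left_mem_uIcc (by rwa [hu])
    have hΓ := (hasDerivAt_velocity hi hxi).differentiableAt.hasDerivAt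
    have hfd := (hf _ (mem_trace hxI)).differentiableAt.hasDerivAt
    have hcomp : HasDerivAt (fun x => f (Γ.toFun x)) (deriv f (Γ.toFun x) * deriv Γ.toFun x) x :=
      hfd.comp x hΓ
    refine (hcomp.mul hEd.neg.cexp).congr_deriv ?_
    have := h0 _ (mem_trace hxI)
    simp only [hG, logDeriv_apply]
    field_simp
    ring
  have hzero := integral_eq_of_hasDerivAt_off_countable_of_le
    (fun x => f (Γ.toFun x) * Complex.exp (-E x)) (fun _ => 0) ht.1 Γ.countable_nodes
    (hcont.mono (Icc_subset_Icc_right ht.2)) hder intervalIntegrable_const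
  have hE0 : E 0 = 0 := intervalIntegral.integral_same
  simp only [intervalIntegral.integral_zero, hE0, neg_zero, Complex.exp_zero, mul_one] at hzero
  rw [← sub_eq_zero.1 hzero.symm, mul_assoc, ← Complex.exp_add]
  simp [hE]

theorem variationOfArgument_le {f : ℂ → ℂ} (hf : AnalyticOnNhd ℂ f Γ.trace)
    (h0 : ∀ z ∈ Γ.trace, f z ≠ 0) :
    variationOfArgument Γ f ≤ ENNReal.ofReal
      (∫ x in (0 : ℝ)..1, |(logDeriv f (Γ.toFun x) * deriv Γ.toFun x).im|) := by
  have hu : uIcc (0 : ℝ) 1 = Icc 0 1 := uIcc_of_le zero_le_one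
  have hL := continuousOn_logDeriv_comp hf h0
  have hint := Γ.intervalIntegrable_mul_deriv ⟨le_rfl, zero_le_one⟩ ⟨zero_le_one, le_rfl⟩
    (h := fun x => logDeriv f (Γ.toFun x)) (by rwa [hu])
  have habs := Γ.intervalIntegrable_abs_im_mul_deriv ⟨le_rfl, zero_le_one⟩ ⟨zero_le_one, le_rfl⟩
    (h := fun x => logDeriv f (Γ.toFun x)) (by rwa [hu])
  set G : ℝ → ℂ := fun x => logDeriv f (Γ.toFun x) * deriv Γ.toFun x with hG
  have hsub : ∀ x ∈ Icc (0 : ℝ) 1, ∀ y ∈ Icc (0 : ℝ) 1, uIcc x y ⊆ uIcc 0 1 :=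
    fun x hx y hy => uIcc_subset_uIcc (by rwa [hu]) (by rwa [hu])
  have h0I : (0 : ℝ) ∈ Icc (0 : ℝ) 1 := ⟨le_rfl, zero_le_one⟩
  -- The imaginary part of the integrated logarithmic derivative, shifted by the initial argument,
  -- is a continuous branch.
  have hbranch : IsArgBranch (f ∘ Γ.toFun)
      (fun t => (f (Γ.toFun 0)).arg + (∫ x in (0 : ℝ)..t, G x).im) := by
    constructor
    · have := intervalIntegral.continuousOn_primitive_interval' hint left_mem_uIcc
      rw [hu] at this
      exact continuousOn_const.add (Complex.continuous_im.comp_continuousOn this)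
    · intro t ht
      have h1 := comp_eq_mul_exp_integral hf h0 ht
      simp only [Function.comp_apply]
      change _ = _ * Complex.exp (∫ x in (0 : ℝ)..t, G x) at h1
      rw [h1, norm_mul, Complex.norm_exp]
      conv_lhs => rw [← Complex.norm_mul_exp_arg_mul_I (f (Γ.toFun 0)),
        ← Complex.re_add_im (∫ x in (0 : ℝ)..t, G x)]
      push_cast
      rw [Complex.exp_add, add_mul, Complex.exp_add]
      ring
  refine (iInf₂_le _ hbranch).trans ?_
  refine (eVariationOn_le_of_abs_sub_le (Φ := fun t => ∫ x in (0 : ℝ)..t, |(G x).im|)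
    zero_le_one ?_).trans ?_
  · intro x hx y hy hxy
    simp only [add_sub_add_left_eq_sub, ← Complex.sub_im]
    rw [intervalIntegral.integral_interval_sub_left (hint.mono_set (hsub 0 h0I y hy))
        (hint.mono_set (hsub 0 h0I x hx)),
      intervalIntegral.integral_interval_sub_left (habs.mono_set (hsub 0 h0I y hy))
        (habs.mono_set (hsub 0 h0I x hx))]
    have h2 := Complex.imCLM.intervalIntegral_comp_comm (hint.mono_set (hsub x hx y hy))
    simp only [Complex.imCLM_apply] at h2
    rw [← h2]
    exact intervalIntegral.abs_integral_le_integral_abs hxy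
  · simp only [intervalIntegral.integral_same, sub_zero]
    exact le_rfl

/-! ## Arcs in a disc -/

theorem curvatureUpTo_mono {s t : ℝ} (hs : 0 ≤ s) (hst : s ≤ t) (ht : t ≤ 1) :
    Γ.curvatureUpTo s ≤ Γ.curvatureUpTo t := by
  have hsI : s ∈ Icc (0 : ℝ) 1 := ⟨hs, hst.trans ht⟩
  have htI : t ∈ Icc (0 : ℝ) 1 := ⟨hs.trans hst, ht⟩
  have h1 := intervalIntegral.integral_add_adjacent_intervals
    (Γ.intervalIntegrable_turning ⟨le_rfl, zero_le_one⟩ hsI)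
    (Γ.intervalIntegrable_turning hsI htI)
  have h2 : 0 ≤ ∫ x in s..t, Γ.turning x :=
    intervalIntegral.integral_nonneg hst fun x _ => abs_nonneg _
  refine add_le_add (by linarith) (Finset.sum_le_sum fun j _ => ?_)
  have h0 := Γ.exteriorAngle_nonneg j
  split_ifs with h5 h6 h6
  · exact le_rfl
  · exact absurd (h5.trans hst) h6
  · exact h0
  · exact le_rfl

theorem integral_abs_im_multiset_sum_le {S : Multiset ℂ} {h : ℝ → ℂ} {s t : ℝ} (hs : 0 ≤ s)
    (hst : s ≤ t) (ht : t ≤ 1) (hS : ∀ a ∈ S, ∀ x ∈ Icc s t, Γ.toFun x ≠ a)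
    (hh : ContinuousOn h (Icc s t)) :
    ∫ x in s..t, |(((S.map fun a => (Γ.toFun x - a)⁻¹).sum + h x) * deriv Γ.toFun x).im| ≤
      Multiset.card S * (Γ.curvatureUpTo t - Γ.curvatureUpTo s + Real.pi) +
        ∫ x in s..t, |(h x * deriv Γ.toFun x).im| := by
  have hsI : s ∈ Icc (0 : ℝ) 1 := ⟨hs, hst.trans ht⟩
  have htI : t ∈ Icc (0 : ℝ) 1 := ⟨hs.trans hst, ht⟩
  have hu : uIcc s t = Icc s t := uIcc_of_le hst
  induction S using Multiset.induction_on generalizing h with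
  | empty => simp
  | cons a S ih =>
    have ha := hS a (Multiset.mem_cons_self a S)
    have hac : ContinuousOn (fun x => (Γ.toFun x - a)⁻¹) (Icc s t) :=
      continuousOn_inv_sub hs ht ha
    -- The term of the root a is absorbed into h for the inductive hypothesis and split off again
    -- afterwards; this is why h varies in the induction.
    have h1 := ih (h := fun x => (Γ.toFun x - a)⁻¹ + h x)
      (fun b hb => hS b (Multiset.mem_cons_of_mem hb)) (hac.add hh)
    have h2 := Γ.integral_abs_im_le hs hst ht ha
    have i1 := Γ.intervalIntegrable_abs_im_mul_deriv hsI htI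
      (h := fun x => (Γ.toFun x - a)⁻¹) (by rwa [hu])
    have i2 := Γ.intervalIntegrable_abs_im_mul_deriv hsI htI (h := h) (by rwa [hu])
    have i3 := Γ.intervalIntegrable_abs_im_mul_deriv hsI htI
      (h := fun x => (Γ.toFun x - a)⁻¹ + h x) (by rw [hu]; exact hac.add hh)
    have h3 : ∫ x in s..t, |(((Γ.toFun x - a)⁻¹ + h x) * deriv Γ.toFun x).im| ≤
        (∫ x in s..t, |((Γ.toFun x - a)⁻¹ * deriv Γ.toFun x).im|) +
          ∫ x in s..t, |(h x * deriv Γ.toFun x).im| := by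
      rw [← intervalIntegral.integral_add i1 i2]
      refine intervalIntegral.integral_mono_on hst i3 (i1.add i2) fun x _ => ?_
      rw [add_mul, Complex.add_im]
      exact abs_add_le _ _
    have e : ∀ x, (((a ::ₘ S).map fun a => (Γ.toFun x - a)⁻¹).sum + h x) =
        (S.map fun a => (Γ.toFun x - a)⁻¹).sum + ((Γ.toFun x - a)⁻¹ + h x) := fun x => by
      rw [Multiset.map_cons, Multiset.sum_cons]; ring
    simp only [e, Multiset.card_cons, Nat.cast_add, Nat.cast_one]
    linarith

/-- The variation of the argument of `f = P g` along an arc in a disc, where `P` is a polynomial and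
`g` has a bounded logarithmic derivative. -/
theorem integral_abs_im_logDeriv_le {f g : ℂ → ℂ} {c : ℂ} {R B s t : ℝ} {S : Multiset ℂ}
    (hs : 0 ≤ s) (hst : s ≤ t) (ht : t ≤ 1)
    (h0 : ∀ z ∈ Γ.trace, f z ≠ 0) (hg : DifferentiableOn ℂ g (ball c R))
    (hfg : ∀ z ∈ ball c R, f z = (S.map fun a => z - a).prod * g z)
    (hΓ : ∀ x ∈ Icc s t, Γ.toFun x ∈ ball c R)
    (hB : ∀ x ∈ Icc s t, ‖logDeriv g (Γ.toFun x)‖ ≤ B) :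
    ∫ x in s..t, |(logDeriv f (Γ.toFun x) * deriv Γ.toFun x).im| ≤
      Multiset.card S * (Γ.curvatureUpTo t - Γ.curvatureUpTo s + Real.pi) +
        B * ∫ x in s..t, ‖deriv Γ.toFun x‖ := by
  have hsI : s ∈ Icc (0 : ℝ) 1 := ⟨hs, hst.trans ht⟩
  have htI : t ∈ Icc (0 : ℝ) 1 := ⟨hs.trans hst, ht⟩
  have hu : uIcc s t = Icc s t := uIcc_of_le hst
  have hsub : Icc s t ⊆ Icc 0 1 := Icc_subset_Icc hs ht
  have hne : ∀ x ∈ Icc s t, (S.map fun a => Γ.toFun x - a).prod ≠ 0 ∧ g (Γ.toFun x) ≠ 0 := by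
    intro x hx
    have h1 := h0 _ (mem_trace (hsub hx))
    rw [hfg _ (hΓ x hx)] at h1
    exact ⟨left_ne_zero_of_mul h1, right_ne_zero_of_mul h1⟩
  have hS : ∀ a ∈ S, ∀ x ∈ Icc s t, Γ.toFun x ≠ a := by
    intro a ha x hx he
    refine (hne x hx).1 (Multiset.prod_eq_zero_iff.2 ?_)
    exact Multiset.mem_map.2 ⟨a, ha, sub_eq_zero.2 he⟩
  have hgc : ContinuousOn (fun x => logDeriv g (Γ.toFun x)) (Icc s t) := by
    intro x hx
    have hga : AnalyticAt ℂ g (Γ.toFun x) := hg.analyticAt (isOpen_ball.mem_nhds (hΓ x hx))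
    have h1 : ContinuousAt (logDeriv g) (Γ.toFun x) :=
      hga.deriv.continuousAt.div hga.continuousAt (hne x hx).2
    exact h1.comp_continuousWithinAt (Γ.continuousOn.mono hsub x hx)
  have hlog : ∀ x ∈ Icc s t, logDeriv f (Γ.toFun x) =
      (S.map fun a => (Γ.toFun x - a)⁻¹).sum + logDeriv g (Γ.toFun x) := by
    intro x hx
    have hev : f =ᶠ[𝓝 (Γ.toFun x)] fun z => (S.map fun a => z - a).prod * g z :=
      eventuallyEq_of_mem (isOpen_ball.mem_nhds (hΓ x hx)) hfg
    have h1 : logDeriv f (Γ.toFun x) =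
        logDeriv (fun z => (S.map fun a => z - a).prod * g z) (Γ.toFun x) := by
      rw [logDeriv_apply, logDeriv_apply, hev.deriv_eq, hev.eq_of_nhds]
    rw [h1, logDeriv_mul (Γ.toFun x) (hne x hx).1 (hne x hx).2 ?_
      (hg.differentiableAt (isOpen_ball.mem_nhds (hΓ x hx))),
      logDeriv_multiset_prod_sub fun a ha => hS a ha x hx]
    exact differentiableAt_multiset_prod_sub S _
  have h1 : ∫ x in s..t, |(logDeriv f (Γ.toFun x) * deriv Γ.toFun x).im| =
      ∫ x in s..t, |(((S.map fun a => (Γ.toFun x - a)⁻¹).sum + logDeriv g (Γ.toFun x)) *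
        deriv Γ.toFun x).im| :=
    intervalIntegral.integral_congr fun x hx => by
      rw [hu] at hx
      simp only [hlog x hx]
  rw [h1]
  refine (integral_abs_im_multiset_sum_le hs hst ht hS hgc).trans (add_le_add le_rfl ?_)
  rw [← intervalIntegral.integral_const_mul]
  refine intervalIntegral.integral_mono_on hst
    (Γ.intervalIntegrable_abs_im_mul_deriv hsI htI (h := fun x => logDeriv g (Γ.toFun x))
      (by rwa [hu])) ((Γ.intervalIntegrable_deriv hsI htI).norm.const_mul B) fun x hx => ?_
  refine (Complex.abs_im_le_norm _).trans ?_
  rw [norm_mul]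
  exact mul_le_mul_of_nonneg_right (hB x hx) (norm_nonneg _)

end PiecewiseSmoothCurve

/-! ## Subdivision into short arcs -/

/-- Cut at a parameter where L has grown by exactly δ, found by the intermediate value theorem. The
increments of Φ and K telescope, while C₂ is paid once per arc. -/
theorem sub_le_of_forall_short {Φ K L : ℝ → ℝ} {δ C₁ C₂ : ℝ} (hδ : 0 ≤ δ)
    (hL : ContinuousOn L (Icc 0 1))
    (h : ∀ s t, 0 ≤ s → s ≤ t → t ≤ 1 → L t - L s ≤ δ → Φ t - Φ s ≤ C₁ * (K t - K s) + C₂)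
    (hC₂ : 0 ≤ C₂) (n : ℕ) :
    ∀ a ∈ Icc (0 : ℝ) 1, L 1 - L a ≤ (n + 1) * δ →
      Φ 1 - Φ a ≤ C₁ * (K 1 - K a) + (n + 1) * C₂ := by
  induction n with
  | zero =>
    intro a ha hLa
    have := h a 1 ha.1 ha.2 le_rfl (by simpa using hLa)
    simpa using this
  | succ n ih =>
    intro a ha hLa
    push_cast at hLa ⊢
    by_cases hs : L 1 - L a ≤ δ
    · have h1 := h a 1 ha.1 ha.2 le_rfl hs
      nlinarith [mul_nonneg (Nat.cast_nonneg (α := ℝ) n) hC₂]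
    · push Not at hs
      obtain ⟨x, hx, hLx⟩ := intermediate_value_Icc ha.2
        (hL.mono (Icc_subset_Icc_left ha.1)) (show L a + δ ∈ Icc (L a) (L 1) from
          ⟨by linarith, by linarith⟩)
      have h1 := h a x ha.1 hx.1 hx.2 (by linarith)
      have h2 := ih x ⟨ha.1.trans hx.1, hx.2⟩ (by linarith)
      linarith

/-- A property that persists over steps of size `δ`, with a parameter that grows by a constant
factor, is transported along a path. -/
theorem chain_along_path {Q : ℝ → ℂ → Prop} {p : ℝ → ℂ} {δ q : ℝ} (hδ : 0 ≤ δ) (hq : 1 ≤ q)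
    (hp : Continuous p)
    (hstep : ∀ s, 0 ≤ s → ∀ x y, dist (p x) (p y) ≤ δ → Q s (p x) → Q (s * q) (p y))
    (hmono : ∀ s s' x, s ≤ s' → Q s (p x) → Q s' (p x)) (n : ℕ) :
    ∀ s, 0 ≤ s → ∀ a ∈ Icc (0 : ℝ) 1, eVariationOn p (Icc a 1) ≤ ENNReal.ofReal (n * δ) →
      Q s (p a) → Q (s * q ^ n) (p 1) := by
  induction n with
  | zero =>
    intro s _ a ha hv hQ
    have h1 := (eVariationOn.edist_le p (left_mem_Icc.2 ha.2) (right_mem_Icc.2 ha.2)).trans hv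
    simp only [Nat.cast_zero, zero_mul, ENNReal.ofReal_zero, nonpos_iff_eq_zero, edist_eq_zero]
      at h1
    simpa [← h1] using hQ
  | succ n ih =>
    intro s hs a ha hv hQ
    by_cases hd : dist (p a) (p 1) ≤ δ
    · refine hmono _ _ _ ?_ (hstep s hs a 1 hd hQ)
      exact mul_le_mul_of_nonneg_left (le_self_pow₀ hq n.succ_ne_zero) hs
    · push Not at hd
      -- The path up to x uses variation at least δ, leaving at most n δ for the rest.
      obtain ⟨x, hx, hxd⟩ := intermediate_value_Icc ha.2
        (f := fun x => dist (p a) (p x)) (by fun_prop)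
        (show δ ∈ Icc (dist (p a) (p a)) (dist (p a) (p 1)) from ⟨by simpa using hδ, hd.le⟩)
      have h1 := ih (s * q) (by positivity) x ⟨ha.1.trans hx.1, hx.2⟩ ?_
        (hstep s hs a x (le_of_eq hxd) hQ)
      · rwa [pow_succ', ← mul_assoc]
      · have h2 := eVariationOn.Icc_add_Icc p (s := univ) hx.1 hx.2 (mem_univ x)
        simp only [univ_inter] at h2
        have h3 := eVariationOn.edist_le p (left_mem_Icc.2 hx.1) (right_mem_Icc.2 hx.1)
        rw [edist_dist, show dist (p a) (p x) = δ from hxd] at h3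
        have h4 : ENNReal.ofReal δ + eVariationOn p (Icc x 1) ≤
            ENNReal.ofReal δ + ENNReal.ofReal (n * δ) := by
          rw [← ENNReal.ofReal_add hδ (by positivity)]
          calc _ ≤ eVariationOn p (Icc a x) + eVariationOn p (Icc x 1) := by gcongr
            _ ≤ _ := by
              rw [h2]
              refine hv.trans_eq ?_
              congr 1
              push_cast
              ring
        exact (ENNReal.add_le_add_iff_left ENNReal.ofReal_ne_top).1 h4

/-! ## Distances to the boundary -/

/-- The ball is connected, meets V and misses its frontier. -/
theorem ball_subset_of_le_setDist {A V : Set ℂ} {ε : ℝ} {z : ℂ} (hV : IsOpen V)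
    (h : ENNReal.ofReal ε ≤ setDist A (frontier V)) (hz : z ∈ A) (hzV : z ∈ V) :
    ball z ε ⊆ V := by
  rcases le_or_gt ε 0 with hε | hε
  · rw [ball_eq_empty.2 hε]; exact empty_subset _
  refine (convex_ball z ε).isPreconnected.subset_left_of_subset_union hV
    isClosed_closure.isOpen_compl
    (disjoint_left.2 fun w hw hw' => hw' (subset_closure hw)) (fun w hw => ?_)
    ⟨z, mem_ball_self hε, hzV⟩
  by_contra hcon
  simp only [mem_union, mem_compl_iff, not_or, not_not] at hcon
  have hwf : w ∈ frontier V := by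
    rw [hV.frontier_eq]; exact ⟨hcon.2, hcon.1⟩
  have h1 : ENNReal.ofReal ε ≤ edist z w := h.trans ((iInf₂_le z hz).trans (iInf₂_le w hwf))
  rw [edist_dist, ENNReal.ofReal_le_ofReal_iff dist_nonneg, dist_comm] at h1
  exact absurd hw (not_lt.2 h1)

/-- Two gaps of width ε are crossed through the midpoint: it lies within ε of z, hence in V, and w
lies within ε of it, hence in W. Taking closures gives the closed ball. -/
theorem closedBall_subset_closure {A V W : Set ℂ} {ε : ℝ} {z : ℂ} (hε : 0 < ε) (hV : IsOpen V)
    (hW : IsOpen W) (hAV : A ⊆ V) (hVW : V ⊆ W)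
    (h₁ : ENNReal.ofReal ε ≤ setDist A (frontier V))
    (h₂ : ENNReal.ofReal ε ≤ setDist V (frontier W)) (hz : z ∈ A) :
    closedBall z (2 * ε) ⊆ closure W := by
  rw [← closure_ball z (by positivity)]
  refine closure_mono fun w hw => ?_
  have hmid : midpoint ℝ z w ∈ V := by
    refine ball_subset_of_le_setDist hV h₁ hz (hAV hz) ?_
    rw [mem_ball, dist_midpoint_left, Real.norm_ofNat, dist_comm]
    rw [mem_ball] at hw
    linarith
  refine ball_subset_of_le_setDist hW h₂ hmid (hVW hmid) ?_
  rw [mem_ball, dist_right_midpoint, Real.norm_ofNat, dist_comm]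
  rw [mem_ball] at hw
  linarith

/-! ## Propagation of lower bounds inside a set of finite intrinsic diameter -/

theorem exists_path_of_intrinsicDiam_le {K : Set ℂ} {D L : ℝ} (hL : 0 < L) (hDL : D < L)
    (h : intrinsicDiam K ≤ ENNReal.ofReal D) {w z : ℂ} (hw : w ∈ K) (hz : z ∈ K) :
    ∃ p : ℝ → ℂ, Continuous p ∧ (∀ t, p t ∈ K) ∧ p 0 = w ∧ p 1 = z ∧
      eVariationOn p (Icc 0 1) ≤ ENNReal.ofReal L := by
  have h1 : intrinsicDist K w z < ENNReal.ofReal L :=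
    (((le_iSup₂ (f := fun y (_ : y ∈ K) => intrinsicDist K w y) z hz).trans
      (le_iSup₂ (f := fun x (_ : x ∈ K) => ⨆ y ∈ K, intrinsicDist K x y) w hw)).trans h).trans_lt
      ((ENNReal.ofReal_lt_ofReal_iff hL).2 hDL)
  simp only [intrinsicDist, iInf_lt_iff] at h1
  obtain ⟨c, hcK, hc⟩ := h1
  refine ⟨c.extend, c.continuous_extend, fun t => hcK _, c.extend_zero, c.extend_one, ?_⟩
  refine le_trans ?_ hc.le
  exact eVariationOn.comp_le_of_monotoneOn (c : unitInterval → ℂ) (projIcc 0 1 zero_le_one)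
    ((monotone_projIcc _).monotoneOn _) (mapsTo_univ _ _)

theorem exists_le_norm_of_intrinsicDiam_le {K W : Set ℂ} {f : ℂ → ℂ} {D ε M b : ℝ} (hε : 0 < ε)
    (hD : 0 ≤ D) (hM : 0 < M) (hb : 0 ≤ b) (hf : AnalyticOnNhd ℂ f W) (hfM : ∀ z ∈ W, ‖f z‖ ≤ M)
    (hball : ∀ z ∈ K, closedBall z (2 * ε) ⊆ W)
    (hdiam : intrinsicDiam K ≤ ENNReal.ofReal D) {w z : ℂ} (hw : w ∈ K) (hz : z ∈ K)
    (hfw : M * Real.exp (-b) ≤ ‖f w‖) :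
    ∃ z₁ ∈ closedBall z (ε / 4), M * Real.exp (-(b * Real.exp (2 * (D / ε) + 1))) ≤ ‖f z₁‖ := by
  have hδ : 0 < ε / 4 := by positivity
  -- The extra 1 makes n ε/4 strictly larger than D, so a path no longer than n ε/4 exists although
  -- the infimum of lengths need not be attained.
  set n := ⌊D / (ε / 4)⌋₊ + 1 with hn
  have hn1 : D < n * (ε / 4) := by
    rw [← div_lt_iff₀ hδ, hn]
    push_cast
    exact Nat.lt_floor_add_one _
  have hn2 : (n : ℝ) ≤ 4 * (D / ε) + 1 := by
    have h1 := Nat.floor_le (show 0 ≤ D / (ε / 4) by positivity)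
    have h2 : D / (ε / 4) = 4 * (D / ε) := by field_simp
    rw [hn]
    push_cast
    linarith
  obtain ⟨p, hp, hpK, hp0, hp1, hpv⟩ :=
    exists_path_of_intrinsicDiam_le (hD.trans_lt hn1) hn1 hdiam hw hz
  have hmono : ∀ s s' : ℝ, s ≤ s' → M * Real.exp (-s') ≤ M * Real.exp (-s) := by
    intro s s' hss
    gcongr
  have h1 := chain_along_path
    (Q := fun s y => ∃ z₁ ∈ closedBall y (ε / 4), M * Real.exp (-s) ≤ ‖f z₁‖) (p := p)
    (δ := ε / 4) (q := 3 / 2) hδ.le (by norm_num) hp ?_ ?_ n b hb 0 ⟨le_rfl, zero_le_one⟩ hpv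
    ⟨w, by rw [hp0]; exact mem_closedBall_self hδ.le, hfw⟩
  · obtain ⟨z₁, hz₁, h2⟩ := h1
    rw [hp1] at hz₁
    refine ⟨z₁, hz₁, (hmono _ _ ?_).trans h2⟩
    refine mul_le_mul_of_nonneg_left ?_ hb
    -- From 3/2 ≤ e^{1/2} and n ≤ 4D/ε + 1.
    calc ((3 : ℝ) / 2) ^ n ≤ Real.exp (1 / 2) ^ n := by
          gcongr
          linarith [Real.add_one_le_exp (1 / 2)]
      _ = Real.exp (n * (1 / 2)) := (Real.exp_nat_mul _ _).symm
      _ ≤ _ := Real.exp_le_exp.2 (by linarith)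
  -- A point within ε/4 of p x is within 2 · ε/4 of p y, which is the middle radius of the three
  -- circles; the outer radius is 8 · ε/4 = 2ε.
  · rintro s hs x y hxy ⟨z₁, hz₁, h2⟩
    have hW : closedBall (p y) (8 * (ε / 4)) ⊆ W := by
      rw [show 8 * (ε / 4) = 2 * ε by ring]
      exact hball _ (hpK y)
    refine exists_le_norm_of_mem_closedBall_two_mul hδ hM hs (hf.mono hW)
      (fun u hu => hfM u (hW hu)) (z := z₁) ?_ h2
    rw [mem_closedBall] at hz₁ ⊢
    linarith [dist_triangle z₁ (p x) (p y)]
  · rintro s s' x hss ⟨z₁, hz₁, h2⟩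
    exact ⟨z₁, hz₁, (hmono s s' hss).trans h2⟩

/-! ## Variation of argument along a short arc -/

theorem PiecewiseSmoothCurve.integral_abs_im_logDeriv_short_le {Γ : PiecewiseSmoothCurve}
    {f : ℂ → ℂ} {z₁ : ℂ} {M ε b s t : ℝ} (hε : 0 < ε) (hM : 0 < M) (hb : 0 < b) (hs : 0 ≤ s)
    (hst : s ≤ t) (ht : t ≤ 1) (h0 : ∀ z ∈ Γ.trace, f z ≠ 0)
    (hlen : ∫ x in s..t, ‖deriv Γ.toFun x‖ ≤ ε / 4)
    (hz₁ : z₁ ∈ closedBall (Γ.toFun s) (ε / 4))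
    (hf : AnalyticOnNhd ℂ f (closedBall z₁ (7 / 4 * ε)))
    (hfM : ∀ z ∈ closedBall z₁ (7 / 4 * ε), ‖f z‖ ≤ M)
    (hfz₁ : M * Real.exp (-b) ≤ ‖f z₁‖) :
    ∫ x in s..t, |(logDeriv f (Γ.toFun x) * deriv Γ.toFun x).im| ≤
      4 * b * (Γ.curvatureUpTo t - Γ.curvatureUpTo s) + 33 * b := by
  have hsI : s ∈ Icc (0 : ℝ) 1 := ⟨hs, hst.trans ht⟩
  -- The arc stays within ε/2 of z₁, which is 2/3 of the zero-free radius 3ε/4, as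
  -- Borel–Carathéodory requires. The outer radius 7ε/4 = 2ε - ε/4 is what fits in the closure of U,
  -- and the ratio 4/3 has logarithm at least 1/4, giving at most 4b roots.
  obtain ⟨S, g, -, hg, hfg, hg0, hcard, hgb⟩ := exists_eq_prod_mul (c := z₁) (ρ := 3 / 4 * ε)
    (R := 7 / 4 * ε) (by positivity) (by linarith) hM hf hfM hfz₁
  have hlog : (1 / 4 : ℝ) ≤ Real.log ((7 / 4 * ε - 3 / 4 * ε) / (3 / 4 * ε)) := by
    rw [show (7 / 4 * ε - 3 / 4 * ε) / (3 / 4 * ε) = 4 / 3 by field_simp; norm_num]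
    have := Real.one_sub_inv_le_log_of_pos (show (0 : ℝ) < 4 / 3 by norm_num)
    norm_num at this ⊢
    exact this
  have hN : (Multiset.card S : ℝ) ≤ 4 * b := by
    have := mul_le_mul_of_nonneg_left hlog (Nat.cast_nonneg (α := ℝ) (Multiset.card S))
    linarith
  have hρ : ball z₁ (3 / 4 * ε) ⊆ closedBall z₁ (7 / 4 * ε) :=
    ball_subset_closedBall.trans (closedBall_subset_closedBall (by linarith))
  have hdist : ∀ x ∈ Icc s t, ‖Γ.toFun x - z₁‖ ≤ ε / 2 := by
    intro x hx
    have h1 := Γ.norm_sub_le_integral hs hx.1 (hx.2.trans ht)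
    have h2 : ∫ y in s..x, ‖deriv Γ.toFun y‖ ≤ ∫ y in s..t, ‖deriv Γ.toFun y‖ := by
      have hxI : x ∈ Icc (0 : ℝ) 1 := ⟨hs.trans hx.1, hx.2.trans ht⟩
      have htI : t ∈ Icc (0 : ℝ) 1 := ⟨hs.trans hst, ht⟩
      rw [← intervalIntegral.integral_add_adjacent_intervals
        (Γ.intervalIntegrable_deriv hsI hxI).norm (Γ.intervalIntegrable_deriv hxI htI).norm]
      have := intervalIntegral.integral_nonneg (f := fun y => ‖deriv Γ.toFun y‖) hx.2
        (μ := volume) fun y _ => norm_nonneg _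
      linarith
    rw [mem_closedBall, dist_comm, dist_eq_norm] at hz₁
    have h3 := norm_add_le (Γ.toFun x - Γ.toFun s) (Γ.toFun s - z₁)
    rw [sub_add_sub_cancel] at h3
    linarith
  -- The constant is 60b / (3ε/4) = 80b/ε; over length ε/4 it contributes 20b, and 4π + 20 < 33.
  have key := Γ.integral_abs_im_logDeriv_le (f := f) (g := g) (c := z₁) (R := 3 / 4 * ε)
    (B := 80 * b / ε) (S := S) hs hst ht h0 (hg.differentiableOn.mono hρ)
    (fun z hz => hfg z (hρ hz)) ?_ ?_
  · refine key.trans ?_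
    have h1 := Γ.curvatureUpTo_mono hs hst ht
    have h2 := mul_le_mul_of_nonneg_right hN
      (show 0 ≤ Γ.curvatureUpTo t - Γ.curvatureUpTo s + Real.pi by linarith [Real.pi_pos])
    have h3 := mul_le_mul_of_nonneg_left hlen (show 0 ≤ 80 * b / ε by positivity)
    have h4 : 80 * b / ε * (ε / 4) = 20 * b := by field_simp; norm_num
    have h5 := mul_le_mul_of_nonneg_left Real.pi_lt_d2.le hb.le
    linarith
  · intro x hx
    rw [mem_ball, dist_eq_norm]
    linarith [hdist x hx]
  · intro x hx
    refine (norm_logDeriv_le (ρ := 3 / 4 * ε) (by positivity) hb (hg.differentiableOn.mono hρ)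
      (fun z hz => hg0 z (ball_subset_closedBall hz)) (fun z hz => hgb z (hρ hz)) ?_).trans_eq ?_
    · linarith [hdist x hx]
    · field_simp
      norm_num

/-! ### The estimate along the whole curve -/

theorem norm_le_of_mem_closure {U : Set ℂ} {f : ℂ → ℂ} {M : ℝ} (hf : ContinuousOn f (closure U))
    (h : ∀ z ∈ U, ‖f z‖ ≤ M) {z : ℂ} (hz : z ∈ closure U) : ‖f z‖ ≤ M :=
  ((hf.norm z hz).mono subset_closure).closure_le hz continuousWithinAt_const h

/-- The bound with an arbitrary number above the Bernstein index. -/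
theorem variationOfArgument_le_of_bernsteinIndex_lt {Γ : PiecewiseSmoothCurve} {K V U : Set ℂ}
    {f : ℂ → ℂ} {D ε b : ℝ} (hΓK : Γ.trace ⊆ K) (hKV : K ⊆ V) (hVU : V ⊆ U) (hVo : IsOpen V)
    (hUo : IsOpen U) (hUc : IsCompact (closure U)) (hf : AnalyticOnNhd ℂ f (closure U))
    (h0 : ∀ z ∈ Γ.trace, f z ≠ 0) (hε : 0 < ε) (hDε : 3 < D / ε)
    (hgap₁ : ENNReal.ofReal ε ≤ setDist K (frontier V))
    (hgap₂ : ENNReal.ofReal ε ≤ setDist V (frontier U))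
    (hdiam : intrinsicDiam K ≤ ENNReal.ofReal D) (hb : bernsteinIndex K U f < b) :
    variationOfArgument Γ f ≤ ENNReal.ofReal
      (b * (Γ.length / ε + Γ.totalCurvature + 1) * Real.exp (5 * D / ε)) := by
  have hKU : K ⊆ closure U := (hKV.trans hVU).trans subset_closure
  have hD : 0 < D := by
    by_contra hneg
    linarith [div_nonpos_of_nonpos_of_nonneg (not_lt.1 hneg) hε.le]
  obtain ⟨C, hC⟩ := hUc.exists_bound_of_continuousOn hf.continuousOn
  set M := sSup ((fun z => ‖f z‖) '' U) with hM
  set m := sSup ((fun z => ‖f z‖) '' K) with hm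
  have hbU : BddAbove ((fun z => ‖f z‖) '' U) := by
    refine ⟨C, ?_⟩; rintro _ ⟨z, hz, rfl⟩; exact hC z (subset_closure hz)
  have hbK : BddAbove ((fun z => ‖f z‖) '' K) := hbU.mono (image_mono (hKV.trans hVU))
  have hp0 : Γ.toFun 0 ∈ Γ.trace := Γ.mem_trace ⟨le_rfl, zero_le_one⟩
  have hm0 : 0 < m := (norm_pos_iff.2 (h0 _ hp0)).trans_le
    (le_csSup hbK (mem_image_of_mem _ (hΓK hp0)))
  have hmM : m ≤ M := csSup_le_csSup hbU ⟨_, mem_image_of_mem _ (hΓK hp0)⟩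
    (image_mono (hKV.trans hVU))
  have hM0 : 0 < M := hm0.trans_le hmM
  have hfM : ∀ z ∈ closure U, ‖f z‖ ≤ M := fun z hz =>
    norm_le_of_mem_closure hf.continuousOn (fun w hw => le_csSup hbU (mem_image_of_mem _ hw)) hz
  have hB : bernsteinIndex K U f = Real.log (M / m) := rfl
  have hb0 : 0 < b := by
    have : 0 ≤ Real.log (M / m) := Real.log_nonneg ((one_le_div hm0).2 hmM)
    linarith
  obtain ⟨w, hw, hfw⟩ : ∃ w ∈ K, M * Real.exp (-b) < ‖f w‖ := by
    have h1 : M * Real.exp (-b) < m := by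
      rw [hB, Real.log_lt_iff_lt_exp (by positivity), div_lt_iff₀ hm0] at hb
      rw [Real.exp_neg, ← div_eq_mul_inv, div_lt_iff₀ (Real.exp_pos b)]
      linarith
    obtain ⟨_, ⟨w, hw, rfl⟩, h2⟩ := exists_lt_of_lt_csSup ⟨_, mem_image_of_mem _ (hΓK hp0)⟩ h1
    exact ⟨w, hw, h2⟩
  have hball : ∀ z ∈ K, closedBall z (2 * ε) ⊆ closure U := fun z hz =>
    closedBall_subset_closure hε hVo hUo hKV hVU hgap₁ hgap₂ hz
  set β := b * Real.exp (2 * (D / ε) + 1) with hβ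
  have hβ0 : 0 < β := by positivity
  have hL := Γ.continuousOn_logDeriv_comp (hf.mono (hΓK.trans hKU)) h0
  have hu : ∀ {s t : ℝ}, s ∈ Icc (0 : ℝ) 1 → t ∈ Icc (0 : ℝ) 1 → uIcc s t ⊆ Icc 0 1 :=
    fun hs ht => uIcc_subset_Icc hs ht
  have h0I : (0 : ℝ) ∈ Icc (0 : ℝ) 1 := ⟨le_rfl, zero_le_one⟩
  have h1I : (1 : ℝ) ∈ Icc (0 : ℝ) 1 := ⟨zero_le_one, le_rfl⟩
  have hLc : ContinuousOn (fun t => ∫ x in (0 : ℝ)..t, ‖deriv Γ.toFun x‖) (Icc 0 1) := by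
    have := intervalIntegral.continuousOn_primitive_interval'
      (Γ.intervalIntegrable_deriv h0I h1I).norm left_mem_uIcc
    rwa [uIcc_of_le zero_le_one] at this
  have hshort : ∀ s t, 0 ≤ s → s ≤ t → t ≤ 1 →
      (∫ x in (0 : ℝ)..t, ‖deriv Γ.toFun x‖) - (∫ x in (0 : ℝ)..s, ‖deriv Γ.toFun x‖) ≤ ε / 4 →
      (∫ x in (0 : ℝ)..t, |(logDeriv f (Γ.toFun x) * deriv Γ.toFun x).im|) -
        (∫ x in (0 : ℝ)..s, |(logDeriv f (Γ.toFun x) * deriv Γ.toFun x).im|) ≤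
      4 * β * (Γ.curvatureUpTo t - Γ.curvatureUpTo s) + 33 * β := by
    intro s t hs hst ht hlen
    have hsI : s ∈ Icc (0 : ℝ) 1 := ⟨hs, hst.trans ht⟩
    have htI : t ∈ Icc (0 : ℝ) 1 := ⟨hs.trans hst, ht⟩
    rw [intervalIntegral.integral_interval_sub_left
      (Γ.intervalIntegrable_deriv h0I htI).norm (Γ.intervalIntegrable_deriv h0I hsI).norm] at hlen
    rw [intervalIntegral.integral_interval_sub_left
      (Γ.intervalIntegrable_abs_im_mul_deriv h0I htI (hL.mono (hu h0I htI)))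
      (Γ.intervalIntegrable_abs_im_mul_deriv h0I hsI (hL.mono (hu h0I hsI)))]
    have hsK : Γ.toFun s ∈ K := hΓK (Γ.mem_trace hsI)
    obtain ⟨z₁, hz₁, hfz₁⟩ := exists_le_norm_of_intrinsicDiam_le hε hD.le hM0 hb0.le hf hfM hball
      hdiam hw hsK hfw.le
    have hsub : closedBall z₁ (7 / 4 * ε) ⊆ closure U := by
      refine Subset.trans (closedBall_subset_closedBall' ?_) (hball _ hsK)
      rw [mem_closedBall] at hz₁
      linarith
    exact Γ.integral_abs_im_logDeriv_short_le hε hM0 hβ0 hs hst ht h0 hlen hz₁ (hf.mono hsub)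
      (fun z hz => hfM z (hsub hz)) hfz₁
  set n := ⌊Γ.length / (ε / 4)⌋₊ with hn
  have hn1 : Γ.length ≤ (n + 1) * (ε / 4) := by
    rw [← div_le_iff₀ (by positivity)]
    exact (Nat.lt_floor_add_one _).le
  have hn2 : (n : ℝ) ≤ 4 * (Γ.length / ε) := by
    refine (Nat.floor_le (div_nonneg Γ.length_nonneg (by positivity))).trans_eq ?_
    field_simp
  have htot := sub_le_of_forall_short (δ := ε / 4) (by positivity) hLc hshort (by positivity) n 0
    h0I (by rw [intervalIntegral.integral_same, sub_zero, ← Γ.length_eq]; exact hn1)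
  rw [intervalIntegral.integral_same, sub_zero, Γ.curvatureUpTo_zero, Γ.curvatureUpTo_one,
    sub_zero] at htot
  refine (Γ.variationOfArgument_le (hf.mono (hΓK.trans hKU)) h0).trans
    (ENNReal.ofReal_le_ofReal (htot.trans ?_))
  have hκ := Γ.totalCurvature_nonneg
  have hlen0 : 0 ≤ Γ.length / ε := div_nonneg Γ.length_nonneg hε.le
  -- The number of arcs is n + 1 ≤ 4|Γ|/ε + 1, and 132 = 4 · 33.
  have e1 : 4 * β * Γ.totalCurvature + (n + 1) * (33 * β) ≤
      132 * β * (Γ.length / ε + Γ.totalCurvature + 1) := by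
    nlinarith [mul_le_mul_of_nonneg_right hn2 hβ0.le, mul_nonneg hβ0.le hκ]
  -- Uses 132 ≤ 2^8 ≤ e^8 and 8 + 1 + 2D/ε ≤ 5D/ε, which is D/ε ≥ 3.
  have e2 : 132 * Real.exp (2 * (D / ε) + 1) ≤ Real.exp (5 * D / ε) := by
    have h8 : (132 : ℝ) ≤ Real.exp 8 := by
      have h2 : (2 : ℝ) ≤ Real.exp 1 := by linarith [Real.add_one_le_exp 1]
      calc (132 : ℝ) ≤ 2 ^ 8 := by norm_num
        _ ≤ Real.exp 1 ^ 8 := by gcongr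
        _ = Real.exp 8 := by rw [← Real.exp_nat_mul]; norm_num
    calc 132 * Real.exp (2 * (D / ε) + 1) ≤ Real.exp 8 * Real.exp (2 * (D / ε) + 1) := by gcongr
      _ = Real.exp (8 + (2 * (D / ε) + 1)) := (Real.exp_add _ _).symm
      _ ≤ _ := Real.exp_le_exp.2 (by rw [mul_div_assoc]; linarith)
  refine e1.trans ?_
  calc 132 * β * (Γ.length / ε + Γ.totalCurvature + 1)
      = b * (Γ.length / ε + Γ.totalCurvature + 1) * (132 * Real.exp (2 * (D / ε) + 1)) := by
        rw [hβ]; ring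
    _ ≤ _ := mul_le_mul_of_nonneg_left e2 (by positivity)

end PlanarArg

end

/-- The bound is continuous in b, so b may tend to the Bernstein index from above. The strict
inequality was needed because the supremum over U'' need not be attained and because
Borel–Carathéodory wants a positive bound, while the index may be 0. -/
theorem theorem1 (Γ : PlanarArg.PiecewiseSmoothCurve) (U'' U' U : Set ℂ)
    (hΓU'' : Γ.trace ⊆ U'') (hU''U' : U'' ⊆ U') (hU'U : U' ⊆ U)
    (hU''o : IsOpen U'') (hU'o : IsOpen U') (hUo : IsOpen U)
    (hU''c : IsPathConnected U'') (hU'c : IsPathConnected U') (hUc : IsPathConnected U)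
    (hUcpt : IsCompact (closure U)) (hUsc : IsSimplyConnected (closure U))
    (f : ℂ → ℂ) (hf : AnalyticOnNhd ℂ f (closure U)) (hfΓ : ∀ z ∈ Γ.trace, f z ≠ 0)
    (D ε : ℝ) (hε : 0 < ε) (hDε : 3 < D / ε)
    (hgap₁ : ENNReal.ofReal ε ≤ PlanarArg.setDist Γ.trace (frontier U''))
    (hgap₂ : ENNReal.ofReal ε ≤ PlanarArg.setDist U'' (frontier U'))
    (hgap₃ : ENNReal.ofReal ε ≤ PlanarArg.setDist U' (frontier U))
    (hdiam₁ : PlanarArg.intrinsicDiam U'' ≤ ENNReal.ofReal D)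
    (hdiam₂ : PlanarArg.intrinsicDiam U' ≤ ENNReal.ofReal D) :
    PlanarArg.variationOfArgument Γ f ≤
      ENNReal.ofReal (PlanarArg.bernsteinIndex U'' U f *
        (Γ.length / ε + Γ.totalCurvature + 1) * Real.exp (5 * D / ε)) := by
  refine ge_of_tendsto (x := nhdsWithin (PlanarArg.bernsteinIndex U'' U f)
    (Ioi (PlanarArg.bernsteinIndex U'' U f)))
    (f := fun b => ENNReal.ofReal (b * (Γ.length / ε + Γ.totalCurvature + 1) *
      Real.exp (5 * D / ε))) ?_ (Filter.eventually_of_mem self_mem_nhdsWithin fun b hb =>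
      PlanarArg.variationOfArgument_le_of_bernsteinIndex_lt hΓU'' hU''U' hU'U hU'o hUo hUcpt hf
        hfΓ hε hDε hgap₂ hgap₃ hdiam₁ hb)
  have hc : Continuous fun b : ℝ => ENNReal.ofReal
      (b * (Γ.length / ε + Γ.totalCurvature + 1) * Real.exp (5 * D / ε)) :=
    ENNReal.continuous_ofReal.comp (by fun_prop)
  exact (hc.tendsto _).mono_left nhdsWithin_le_nhds
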